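/- Setting. Let $s\ge 1$ and let $\mathcal H$ be a real reproducing kernel Hilbert space of functions on $\mathbb R^s$ with continuous kernel $K:\mathbb R^s\times\mathbb R^s\to\mathbb R$ and feature map $\varphi(\omega)=K(\cdot,\omega)$. Let $\Omega\subset\mathbb R^s$ be compact, and let the instance space $\mathcal X=\varphi(\Omega)$ lie in the closed unit ball $B$ of $\mathcal H$. Let $y:\mathcal X\to\{-1,1\}$ be labels. A set $F\subset\mathcal H$ correctly classifies $x$ if $y(x)=1\Rightarrow x\in F$ and $y(x)=-1\Rightarrow x\notin F$. A halfspace is a set $\{z:\langle z,h\rangle+d\ge 0\}$ with $(h,d)\in\mathcal H\times\mathbb R$, and a $t$-polyhedron is an intersection of $t$ halfspaces. For a halfspace $H$, $H^\gamma$ is $H$ together with all points at distance at most $\gamma$ from $\partial H$. Assume that $0<\gamma\le 2$, $t\ge 1$, and that there is a $t$-polyhedron $F^*=\bigcap_{i\le t}H_i$ which correctly classifies $\mathcal X$ and whose $\gamma$-margin $\bigcap_i H_i^\gamma\setminus F^*$ does not meet $\mathcal X$. Algorithms. Fix $\beta>0$. Let $\omega^\#$ be a closest point to $\omega$ in the lattice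 $\beta\mathbb Z^s$ (obtained by rounding coordinatewise), and put $v(\omega)=y(\varphi(\omega))\,(\mathrm{proj}_B\,\varphi(\omega^\#),1)\in\mathcal H\times\mathbb R$. A state $S$ is either empty, with $H_S=\mathcal H$, or a pair $u=(h,d)$, with $H_S=\{z:\langle z,h\rangle+d\ge 0\}$. * LP algorithm, on a state and a finite set $A\subset\Omega$. The empty state is replaced by $v(\omega)$ for some $\omega\in A$. In a state $u=(h,d)$: if $y(x)(\langle x,h\rangle+d)>0$ for all $x=\varphi(\omega)$, $\omega\in A$, then stop and return $u$. Otherwise pick $\omega\in A$ violating this, let $v=v(\omega)$ and $\alpha=\langle v,v-u\rangle/\|v-u\|^2$. If $\|\alpha u+(1-\alpha)v\|\le\gamma/4$, stop and report failure. Otherwise continue with the state $\alpha' u+(1-\alpha')v$, where $\alpha'=\beta\lfloor\alpha/\beta\rfloor$. * Separation algorithm (proper), on a finite sample $X\subset\Omega$ with positives $X^+$ and negatives $X^-$. It keeps a finite set of nodes $(A,S)$, initially only $(X^+,\emptyset)$. If some at most $t$ nodes have $\bigcap H_S$ correctly classifying $X$, return this intersection. Otherwise, for all nodes $(A,S)$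 and all $\omega\in X^-$ with $\varphi(\omega)\in H_S$, run the LP algorithm on $A\cup\{\omega\}$ starting from $S$, and unless it reports failure add the node $(A\cup\{\omega\},S')$ with the state $S'$ that it returns. All old nodes are kept. Repeat. * Improper-separation algorithm. It keeps nodes in the same way. Let $F$ be the intersection of $H_S$ over all nodes. If $F$ correctly classifies $X$, return $F$. Otherwise pick a misclassified $\omega\in X$, and for every node $(A,S)$ run the LP algorithm on $A\cup\{\omega\}$ starting from $S$, adding the new node unless failure is reported. Repeat. Call $\beta>0$ admissible (for a constant $c>0$) if $\beta\le c\gamma^2$ and $\|\varphi(\omega)-\varphi(\omega^\#)\|\le c\gamma$ for all $\omega\in\Omega$. Theorem. There are universal constants $C,c>0$ such that in every setting as above the following holds. 1. All sufficiently small $\beta>0$ are admissible. If moreover $\Omega\subset[0,1]^s$ and $K$ is Lipschitz on $[0,2]^s$ in one variable with constant $L\ge 0$, uniformly in the other variable in $[0,2]^s$ (for a $C^1$ kernel such an $L$ exists), then every $0<\beta\le c^2\gamma^2/(1+\sqrt s\,L)$ is admissible. 2. Let $\beta$ be admissible, and let the arbitrary choices of elements of finite sets be made by any fixed rule that assigns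 to every nonempty finite set one of its elements. Then on every finite sample $X\subset\Omega$ both algorithms stop after at most $Ct\gamma^{-2}$ branching steps, with at most $C\gamma^{-2}$ iterations in every call of the LP algorithm, and every polyhedron that they return correctly classifies $X$. It is a $t'$-polyhedron with $t'\le t$ for the separation algorithm, and with $t'\le N:=(t+1)^{C\gamma^{-2}}$ for the improper-separation algorithm. 3. Moreover both algorithms are PAC learners. Let $\varepsilon,\delta\in(0,1/2)$ and let $P$ be any probability distribution on $\Omega$. With probability at least $1-\delta$ over a sample of $m$ independent draws from $P$, every polyhedron returned on the sample correctly classifies $\varphi(\omega)$ for all $\omega$ outside a set of $P$-measure at most $\varepsilon$, provided that $$m\ \ge\ \frac C\varepsilon\Bigl(D\log\frac1\varepsilon+\log\frac1\delta\Bigr),$$ where $D=t\gamma^{-2}\log(2+t\gamma^{-2})$ for the separation algorithm, so that its sample complexity is polynomially bounded in $s$, $\gamma^{-1}$ and $t$ (independently of $K$ and $\Omega$), and $D=N$ for the improper-separation algorithm (that is, $t$ is replaced by $t^{O(\gamma^{-2})}$ for $t\ge 2$). If $\Omega\subset[0,1]^s$, then $$m\ \ge\ \frac C\varepsilon\Bigl(D'+\log\frac1\delta\Bigr)$$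 also suffices, where $D'=s\,t\,\gamma^{-2}\log(1/\beta)$ for the separation algorithm and $D'=s\,N\log(1/\beta)$ for the improper-separation algorithm. -/

import Mathlib

/-! Definitions for learning polyhedra in a reproducing kernel Hilbert space. -/

open MeasureTheory

namespace RKHSPoly

noncomputable section

/-- The Euclidean space `ℝ^s`. -/
abbrev Euc (s : ℕ) := EuclideanSpace ℝ (Fin s)

variable {s : ℕ} {H : Type*} [NormedAddCommGroup H] [InnerProductSpace ℝ H]

/-! ### Halfspaces, polyhedra, margins, classification -/

/-- The halfspace `{z | ⟨z, h⟩ + d ≥ 0}`. -/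
def halfspace (h : H) (d : ℝ) : Set H := {z | 0 ≤ inner ℝ z h + d}

/-- A `t`-polyhedron: an intersection of `t` halfspaces. -/
def IsPolyhedron (t : ℕ) (F : Set H) : Prop :=
  ∃ (h : Fin t → H) (d : Fin t → ℝ), F = ⋂ i, halfspace (h i) (d i)

/-- The `γ`-margin of a halfspace `S`: all points whose distance to the boundary of `S` is at
most `γ` (the distance to an empty boundary is `∞`). -/
def margin (γ : ℝ) (S : Set H) : Set H :=
  {z | Metric.infEDist z (frontier S) ≤ ENNReal.ofReal γ}

/-- `S^γ`: the union of a halfspace `S` and its `γ`-margin. -/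
def enlarge (γ : ℝ) (S : Set H) : Set H := S ∪ margin γ S

/-- The classifier `F` assigns the correct label to `x`. -/
def CorrectlyClassifies (y : H → ℝ) (F : Set H) (x : H) : Prop :=
  (y x = 1 → x ∈ F) ∧ (y x = -1 → x ∉ F)

/-- The polyhedron `F = ⋂ i, halfspace (h i) (d i)` correctly classifies all of `X`, and its
`γ`-margin `F^γ \ F` does not meet `X`. -/
def GammaSeparates {t : ℕ} (X : Set H) (y : H → ℝ) (γ : ℝ) (h : Fin t → H) (d : Fin t → ℝ) :
    Prop :=
  (∀ x ∈ X, CorrectlyClassifies y (⋂ i, halfspace (h i) (d i)) x) ∧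
    Disjoint ((⋂ i, enlarge γ (halfspace (h i) (d i))) \ ⋂ i, halfspace (h i) (d i)) X

/-! ### The kernel and the feature map of a reproducing kernel Hilbert space -/

/-- The feature map `ω ↦ K(·, ω)` of a real RKHS `H`. -/
def featureMap (H : Type*) [NormedAddCommGroup H] [InnerProductSpace ℝ H] [CompleteSpace H]
    [RKHS ℝ H (Euc s) ℝ] (ω : Euc s) : H := RKHS.kerFun H ω (1 : ℝ)

/-- The scalar kernel `K(ω, ω')` of a real RKHS `H`. -/
def scalarKernel (H : Type*) [NormedAddCommGroup H] [InnerProductSpace ℝ H] [CompleteSpace H]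
    [RKHS ℝ H (Euc s) ℝ] (ω ω' : Euc s) : ℝ := RKHS.kernel H ω ω' (1 : ℝ)

/-! ### Discretization -/

/-- `ω^#`: a closest point to `ω` in the lattice `β ℤ^s`. -/
def latticePoint (β : ℝ) (ω : Euc s) : Euc s :=
  WithLp.toLp 2 fun i => β * (round (ω i / β) : ℝ)

/-- Orthogonal projection onto the closed unit ball centered at the origin. -/
def projBall (z : H) : H := (max 1 ‖z‖)⁻¹ • z

/-- The step `β` is fine enough for the margin `γ`: it is at most `c γ²`, and on `Ω` the feature
map moves by at most `c γ` when points are rounded to the lattice `β ℤ^s`. -/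
def AdmissibleStep (φ : Euc s → H) (Ω : Set (Euc s)) (γ c β : ℝ) : Prop :=
  0 < β ∧ β ≤ c * γ ^ 2 ∧ ∀ ω ∈ Ω, ‖φ ω - φ (latticePoint β ω)‖ ≤ c * γ

/-! ### The modified LP algorithm -/

/-- What an implementation has at its disposal: the feature map, the labels, the margin `γ`, the
step `β` of discretization and rounding, and a rule `pick` resolving the instructions "pick an
arbitrary element of a (nonempty) finite set". -/
structure Impl (s : ℕ) (H : Type*) where
  φ : Euc s → H
  y : H → ℝ
  γ : ℝ
  β : ℝ
  pick : Finset (Euc s) → Euc s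
  pick_mem : ∀ A : Finset (Euc s), A.Nonempty → pick A ∈ A

/-- The product Hilbert space `H × ℝ`, with `⟨(h₁, d₁), (h₂, d₂)⟩ = ⟨h₁, h₂⟩ + d₁ d₂`. -/
abbrev Aff (H : Type*) := WithLp 2 (H × ℝ)

/-- A state of the LP algorithm: `none` is the empty state, `some (h, d)` a nonempty one. -/
abbrev State (H : Type*) := Option (Aff H)

/-- The set of points accepted by a state: the whole space for the empty state. -/
def State.region : State H → Set H
  | none => Set.univ
  | some u => halfspace u.fst u.snd

/-- Configurations of the LP algorithm: still running in a state; stopped at a feasible `(h, d)`;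
stopped with the report that the input is not linearly separable with the required margin. -/
inductive LPConfig (H : Type*) where
  | active (S : State H)
  | found (u : Aff H)
  | report

namespace Impl

variable (I : Impl s H)

/-- The vector `y(x) (x^#, 1)`, where `x = φ(ω)` and `x^# = proj_B (φ(ω^#))`. -/
def vec (ω : Euc s) : Aff H :=
  WithLp.toLp 2 (I.y (I.φ ω) • (projBall (I.φ (latticePoint I.β ω)), (1 : ℝ)))

open scoped Classical in
/-- The points `ω ∈ A` whose (original) constraint `y(x) (⟨x, h⟩ + d) > 0`, with `x = φ(ω)`, is
violated by `u = (h, d)`. -/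
def violated (A : Finset (Euc s)) (u : Aff H) : Finset (Euc s) :=
  A.filter fun ω => I.y (I.φ ω) * (inner ℝ (I.φ ω) u.fst + u.snd) ≤ 0

/-- The coefficient `α` such that `α u + (1 - α) v` is the projection of the origin. -/
def projCoeff (u v : Aff H) : ℝ := inner ℝ v (v - u) / ‖v - u‖ ^ 2

/-- The combination `a u + (1 - a) v`. -/
def combine (a : ℝ) (u v : Aff H) : Aff H := a • u + (1 - a) • v

open scoped Classical in
/-- One iteration of the modified LP algorithm on the input `A`. If some constraint is violated, a
violated one is picked, the projection of the origin on the segment between `u` and the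
discretized constraint vector is computed, the algorithm reports failure if this projection has
norm at most `γ / 4`, and otherwise moves to the point with the coefficient rounded to `β ℤ`. -/
def lpStep (A : Finset (Euc s)) : LPConfig H → LPConfig H
  | .active none => .active (some (I.vec (I.pick A)))
  | .active (some u) =>
      if I.violated A u = ∅ then .found u
      else
        let v := I.vec (I.pick (I.violated A u))
        let α := projCoeff u v
        if ‖combine α u v‖ ≤ I.γ / 4 then .report
        else .active (some (combine (I.β * (⌊α / I.β⌋ : ℝ)) u v))
  | .found u => .found u
  | .report => .report

/-- The configuration after `n` iterations, started in state `S` on the input `A`. -/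
def lpRun (S : State H) (A : Finset (Euc s)) (n : ℕ) : LPConfig H :=
  (I.lpStep A)^[n] (.active S)

/-- The LP algorithm, started in state `S` on the input `A`, stops within `N` iterations. -/
def LPHaltsWithin (N : ℝ) (S : State H) (A : Finset (Euc s)) : Prop :=
  ∃ n : ℕ, (n : ℝ) ≤ N ∧ ∀ S' : State H, I.lpRun S A n ≠ .active S'

open scoped Classical in
/-- The result `LP(S, A)`: `some u` if the algorithm stops at a feasible `u`; `none` otherwise. -/
def lpOut (S : State H) (A : Finset (Euc s)) : Option (Aff H) :=
  if h : ∃ u : Aff H, ∃ n : ℕ, I.lpRun S A n = .found u then some h.choose else none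

/-! ### The two separation algorithms -/

/-- A node of the search tree: a set `A` of sample points with the state stored for it. -/
abbrev Node (s : ℕ) (H : Type*) := Finset (Euc s) × State H

open scoped Classical in
/-- The positive sample points `X⁺`. -/
def pos (X : Finset (Euc s)) : Finset (Euc s) := X.filter fun ω => I.y (I.φ ω) = 1

open scoped Classical in
/-- The negative sample points `X⁻`. -/
def neg (X : Finset (Euc s)) : Finset (Euc s) := X.filter fun ω => I.y (I.φ ω) = -1

/-- The intersection of the regions of the states stored at the nodes in `G`. -/
def poly (G : Finset (Node s H)) : Set H := ⋂ n ∈ G, n.2.region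

/-- `F` correctly classifies the sample `X`. -/
def ConsistentOn (X : Finset (Euc s)) (F : Set H) : Prop :=
  ∀ ω ∈ X, CorrectlyClassifies I.y F (I.φ ω)

open scoped Classical in
/-- The new node `(A ∪ {x}, LP(S, A ∪ {x}))`, unless the LP algorithm reports failure. -/
def child (n : Node s H) (x : Euc s) : Finset (Node s H) :=
  match I.lpOut n.2 (insert x n.1) with
  | some u => {(insert x n.1, some u)}
  | none => ∅

open scoped Classical in
/-- The calls `(S, A ∪ {x})` of the LP algorithm in a branching step of the separation algorithm:
all nodes `(A, S)` and all negative sample points `x` accepted by `S`. -/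
def properCalls (X : Finset (Euc s)) (N : Finset (Node s H)) : Finset (Node s H × Euc s) :=
  (N ×ˢ I.neg X).filter fun p => I.φ p.2 ∈ p.1.2.region

open scoped Classical in
/-- The levels of the search tree of the (proper) separation algorithm. -/
def properLevel (X : Finset (Euc s)) : ℕ → Finset (Node s H)
  | 0 => {(I.pos X, none)}
  | k + 1 => properLevel X k ∪
      (I.properCalls X (properLevel X k)).biUnion fun p => I.child p.1 p.2

open scoped Classical in
/-- The choices of at most `t` nodes of level `k` that give a polyhedron consistent with `X`. -/
def properFound (t : ℕ) (X : Finset (Euc s)) (k : ℕ) : Finset (Finset (Node s H)) :=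
  (I.properLevel X k).powerset.filter fun G => G.card ≤ t ∧ I.ConsistentOn X (poly G)

/-- The separation algorithm may return `F` on the sample `X`: `F` is a consistent intersection of
at most `t` stored regions, at the first level where such an intersection exists. -/
def ProperReturns (t : ℕ) (X : Finset (Euc s)) (F : Set H) : Prop :=
  ∃ k, (∀ j < k, I.properFound t X j = ∅) ∧ ∃ G ∈ I.properFound t X k, F = poly G

/-- The separation algorithm stops on `X` after at most `M` branching steps, all of whose calls of
the LP algorithm stop within `N` iterations. -/
def ProperHaltsWithin (M N : ℝ) (t : ℕ) (X : Finset (Euc s)) : Prop :=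
  ∃ k : ℕ, (k : ℝ) ≤ M ∧ (I.properFound t X k).Nonempty ∧
    ∀ j < k, ∀ p ∈ I.properCalls X (I.properLevel X j),
      I.LPHaltsWithin N p.1.2 (insert p.2 p.1.1)

open scoped Classical in
/-- The sample points misclassified by the intersection of all regions stored in `N`. -/
def misclassified (X : Finset (Euc s)) (N : Finset (Node s H)) : Finset (Euc s) :=
  X.filter fun ω => ¬ CorrectlyClassifies I.y (poly N) (I.φ ω)

open scoped Classical in
/-- The levels of the search tree of the improper-separation algorithm. -/
def improperLevel (X : Finset (Euc s)) : ℕ → Finset (Node s H)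
  | 0 => {(I.pos X, none)}
  | k + 1 =>
      if I.misclassified X (improperLevel X k) = ∅ then improperLevel X k
      else improperLevel X k ∪ (improperLevel X k).biUnion fun n =>
        I.child n (I.pick (I.misclassified X (improperLevel X k)))

/-- The improper-separation algorithm returns `F` on the sample `X`: `F` is the intersection of
all regions stored at the first level where this intersection is consistent with `X`. -/
def ImproperReturns (X : Finset (Euc s)) (F : Set H) : Prop :=
  ∃ k, (∀ j < k, I.misclassified X (I.improperLevel X j) ≠ ∅) ∧
    I.misclassified X (I.improperLevel X k) = ∅ ∧ F = poly (I.improperLevel X k)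

/-- The improper-separation algorithm stops on `X` after at most `M` branching steps, all of whose
calls of the LP algorithm stop within `N` iterations. -/
def ImproperHaltsWithin (M N : ℝ) (X : Finset (Euc s)) : Prop :=
  ∃ k : ℕ, (k : ℝ) ≤ M ∧ I.misclassified X (I.improperLevel X k) = ∅ ∧
    ∀ j < k, I.misclassified X (I.improperLevel X j) ≠ ∅ →
      ∀ n ∈ I.improperLevel X j,
        I.LPHaltsWithin N n.2 (insert (I.pick (I.misclassified X (I.improperLevel X j))) n.1)

/-! ### PAC guarantee -/

open scoped Classical in
/-- The sample (as a finite set) formed by `m` draws. -/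
def sampleSet {m : ℕ} (w : Fin m → Euc s) : Finset (Euc s) := Finset.univ.image w

/-- The algorithm whose outputs are described by `returns` is probably approximately correct with
accuracy `1 - ε` and confidence `1 - δ` on `m` independent draws: for every distribution `P` on
`Ω`, with probability at least `1 - δ` every polyhedron `F` that it returns misclassifies a set of
`P`-measure at most `ε`. (Possibly nonmeasurable events are bounded in outer measure.) -/
def IsPAC (returns : Finset (Euc s) → Set H → Prop) (Ω : Set (Euc s)) (ε δ : ℝ) (m : ℕ) : Prop :=
  ∀ P : Measure (Euc s), IsProbabilityMeasure P → P Ωᶜ = 0 →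
    Measure.pi (fun _ : Fin m => P)
      {w | ∃ F, returns (sampleSet w) F ∧
        ENNReal.ofReal ε < P {ω | ¬ CorrectlyClassifies I.y F (I.φ ω)}} ≤ ENNReal.ofReal δ

end Impl

end

end RKHSPoly

namespace RKHSPoly

variable {s : ℕ} {H : Type*} [NormedAddCommGroup H] [InnerProductSpace ℝ H]

/-! ### The feature map and lattice rounding -/

/-! An extra coordinate turns halfspaces into vectors of `H × ℝ`. Moving the boundary of each
halfspace of the target to the middle of its margin and normalizing gives a vector of norm at most 1
with functional margin 7γ/20 on all positive points and on the negative points cut off by that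
halfspace; every negative point is cut off by one of them (`exists_separator`, `Regular.separable`).
Discretization costs at most γ/100, so more than γ/4 remains.

An LP update replaces `u` by nearly the closest point to the origin on the segment from `u` to a
violated constraint vector. The potential 16/‖u‖² (`energy`) grows by at least 1 per update
(`rounded_step_bounds`), while ‖u‖ > γ/4 keeps it below 256/γ². Children inherit the state of their
parent, so O(γ⁻²) bounds the updates along a whole branch of the search tree, not only those of one
call. States are convex combinations of constraint vectors, so a separator with margin above γ/4
forces ‖u‖ > γ/4 and rules out a report of failure (`Regular.lpStep_separated`).

To bound the branching steps, follow t nodes, the i-th holding only points separated by the i-th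
vector. A point misclassified by their intersection is negative and accepted by all of them; some
vector cuts it off, and the corresponding node has a child of larger energy. The total energy is at
most 256t/γ², so the search stops (`Regular.exists_stop`). The size of the improper tree is
controlled by a generating function in the energy (`Regular.sum_improperLevel_le`).

Generalization is sample compression. A state is determined by the list of at most 256/γ² points
used in its updates (`Derived`), so an output is described by few sample indices or, in the unit
cube, by few signed lattice points. A union bound over these encodings
(`measure_pi_exists_consistent_le`) gives the PAC guarantee. The labels need not be measurable;
membership in the closed target polyhedron replaces them. -/

theorem inner_featureMap [CompleteSpace H] [RKHS ℝ H (Euc s) ℝ] (a b : Euc s) :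
    inner ℝ (featureMap H a) (featureMap H b) = scalarKernel H b a := by
  have h := RKHS.kernel_inner (𝕜 := ℝ) H b a (1 : ℝ) (1 : ℝ)
  simp only [featureMap, scalarKernel]
  rw [← h]
  simp

/-- Each bracket varies only one argument of the kernel, so a Lipschitz bound in one variable
controls it. -/
theorem norm_featureMap_sub_sq [CompleteSpace H] [RKHS ℝ H (Euc s) ℝ] (a b : Euc s) :
    ‖featureMap H a - featureMap H b‖ ^ 2 =
      (scalarKernel H a a - scalarKernel H a b) + (scalarKernel H b b - scalarKernel H b a) := by
  rw [@norm_sub_sq_real, ← real_inner_self_eq_norm_sq, ← real_inner_self_eq_norm_sq,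
    inner_featureMap, inner_featureMap, inner_featureMap]
  have : scalarKernel H a b = scalarKernel H b a := by
    rw [← inner_featureMap, ← inner_featureMap, real_inner_comm]
  linarith

theorem continuous_featureMap [CompleteSpace H] [RKHS ℝ H (Euc s) ℝ]
    (hK : Continuous fun p : Euc s × Euc s => scalarKernel H p.1 p.2) :
    Continuous (featureMap H : Euc s → H) := by
  rw [continuous_iff_continuousAt]
  intro a
  rw [ContinuousAt, tendsto_iff_norm_sub_tendsto_zero]
  have h1 : Continuous fun b : Euc s => ‖featureMap H b - featureMap H a‖ ^ 2 := by
    simp only [norm_featureMap_sub_sq]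
    have e : ∀ f g : Euc s → Euc s, Continuous f → Continuous g →
        Continuous fun b => scalarKernel H (f b) (g b) :=
      fun f g hf hg => by
        have := Continuous.comp hK (Continuous.prodMk hf hg)
        simpa only [Function.comp_def] using this
    have e1 := e (fun b => b) (fun b => b) continuous_id continuous_id
    have e2 := e (fun b => b) (fun _ => a) continuous_id continuous_const
    have e3 := e (fun _ => a) (fun b => b) continuous_const continuous_id
    exact Continuous.add (Continuous.sub e1 e2) (Continuous.sub continuous_const e3)
  have h2 := (Real.continuous_sqrt.comp h1).tendsto a
  simpa [Function.comp_def, Real.sqrt_sq] using h2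

theorem abs_sub_mul_round_le {β : ℝ} (hβ : 0 < β) (x : ℝ) :
    |x - β * (round (x / β) : ℝ)| ≤ β / 2 := by
  have h := abs_sub_round (x / β)
  have e : x - β * (round (x / β) : ℝ) = β * (x / β - round (x / β)) := by
    field_simp
  rw [e, abs_mul, abs_of_pos hβ]
  nlinarith

theorem norm_sub_latticePoint_le {β : ℝ} (hβ : 0 < β) (ω : Euc s) :
    ‖ω - latticePoint β ω‖ ≤ √(s : ℝ) * (β / 2) := by
  rw [EuclideanSpace.norm_eq]
  have h : ∑ i, ‖(ω - latticePoint β ω) i‖ ^ 2 ≤ (s : ℝ) * (β / 2) ^ 2 := by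
    calc ∑ i, ‖(ω - latticePoint β ω) i‖ ^ 2 ≤ ∑ _i : Fin s, (β / 2) ^ 2 := by
          refine Finset.sum_le_sum fun i _ => ?_
          have := abs_sub_mul_round_le hβ (ω i)
          simp only [latticePoint, PiLp.sub_apply, Real.norm_eq_abs]
          gcongr
      _ = (s : ℝ) * (β / 2) ^ 2 := by simp
  calc √(∑ i, ‖(ω - latticePoint β ω) i‖ ^ 2) ≤ √((s : ℝ) * (β / 2) ^ 2) := Real.sqrt_le_sqrt h
    _ = √(s : ℝ) * (β / 2) := by
      rw [Real.sqrt_mul (by positivity), Real.sqrt_sq (by positivity)]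

/-- Rounding can leave the unit cube, but only by β/2 ≤ 1; this is why the kernel is controlled on
the cube of side 2. -/
theorem latticePoint_mem_Icc {β : ℝ} (hβ : 0 < β) (hβ2 : β ≤ 2) {ω : Euc s}
    (hω : ∀ i, ω i ∈ Set.Icc (0 : ℝ) 1) (i : Fin s) :
    latticePoint β ω i ∈ Set.Icc (0 : ℝ) 2 := by
  have h1 := abs_le.1 (abs_sub_mul_round_le hβ (ω i))
  have h2 := hω i
  have h3 : (0 : ℤ) ≤ round (ω i / β) := by
    rw [round_eq]
    apply Int.floor_nonneg.2
    have := div_nonneg h2.1 hβ.le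
    linarith
  have h4 : (0 : ℝ) ≤ (round (ω i / β) : ℝ) := by exact_mod_cast h3
  simp only [latticePoint]
  exact ⟨by positivity, by linarith [h2.2, h1.1]⟩

omit [InnerProductSpace ℝ H] in
theorem exists_admissibleStep {φ : Euc s → H} (hφ : Continuous φ) {Ω : Set (Euc s)}
    (hΩ : IsCompact Ω) {γ c : ℝ} (hγ : 0 < γ) (hc : 0 < c) :
    ∃ β₀ > 0, ∀ β, 0 < β → β ≤ β₀ → AdmissibleStep φ Ω γ c β := by
  -- The lattice point may lie outside Ω, so uniform continuity is needed in the form where only one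
  -- of the two points is in the compact set.
  have h := hΩ.uniformContinuousAt_of_continuousAt φ (fun a _ => hφ.continuousAt)
    (Metric.dist_mem_uniformity (mul_pos hc hγ))
  obtain ⟨δ, hδ, hδ'⟩ := Metric.mem_uniformity_dist.1 h
  have hs : (0 : ℝ) < √(s : ℝ) + 1 := by positivity
  refine ⟨min (c * γ ^ 2) (δ / (√(s : ℝ) + 1)), by positivity, fun β hβ hβ' => ⟨hβ, ?_, ?_⟩⟩
  · exact hβ'.trans (min_le_left _ _)
  · intro ω hω
    have h1 : β * (√(s : ℝ) + 1) ≤ δ := by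
      rw [← le_div_iff₀ hs]
      exact hβ'.trans (min_le_right _ _)
    have h2 : dist ω (latticePoint β ω) < δ := by
      rw [dist_eq_norm]
      have := norm_sub_latticePoint_le hβ ω
      have h0 : 0 ≤ √(s : ℝ) * β := by positivity
      nlinarith
    have h3 := hδ' h2 hω
    simp only [Set.mem_ofPred_eq, dist_eq_norm] at h3
    exact h3.le

theorem admissibleStep_of_lipschitz [CompleteSpace H] [RKHS ℝ H (Euc s) ℝ] {Ω : Set (Euc s)}
    {γ c L : ℝ} (hγ : 0 < γ) (hγ2 : γ ≤ 2) (hc : 0 < c) (hc1 : c ≤ 1 / 2) (hL : 0 ≤ L)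
    (hΩ : ∀ ω ∈ Ω, ∀ i, ω i ∈ Set.Icc (0 : ℝ) 1)
    (hK : ∀ a b b' : Euc s, (∀ i, a i ∈ Set.Icc (0 : ℝ) 2) →
      (∀ i, b i ∈ Set.Icc (0 : ℝ) 2) → (∀ i, b' i ∈ Set.Icc (0 : ℝ) 2) →
      |scalarKernel H a b - scalarKernel H a b'| ≤ L * ‖b - b'‖)
    {β : ℝ} (hβ : 0 < β) (hβ' : β ≤ c ^ 2 * γ ^ 2 / (1 + √(s : ℝ) * L)) :
    AdmissibleStep (featureMap H) Ω γ c β := by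
  have hs : 0 ≤ √(s : ℝ) * L := by positivity
  have h1 : β * (1 + √(s : ℝ) * L) ≤ c ^ 2 * γ ^ 2 := by
    rwa [← le_div_iff₀ (by positivity)]
  have h2 : 0 ≤ β * (√(s : ℝ) * L) := by positivity
  have h3 : β ≤ c ^ 2 * γ ^ 2 := by nlinarith
  have h4 : β ≤ c * γ ^ 2 := by
    refine h3.trans ?_
    have : 0 < c * γ ^ 2 := by positivity
    nlinarith
  have h5 : β ≤ 2 := by
    have : γ ^ 2 ≤ 4 := by nlinarith
    nlinarith
  refine ⟨hβ, h4, fun ω hω => ?_⟩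
  have m1 : ∀ i, ω i ∈ Set.Icc (0 : ℝ) 2 := fun i =>
    ⟨(hΩ ω hω i).1, (hΩ ω hω i).2.trans (by norm_num)⟩
  have m2 := latticePoint_mem_Icc hβ h5 (hΩ ω hω)
  have k1 := le_of_abs_le (hK ω ω _ m1 m1 m2)
  have k2 := le_of_abs_le (hK (latticePoint β ω) _ ω m2 m2 m1)
  have k3 := norm_sub_latticePoint_le hβ ω
  rw [norm_sub_rev] at k2
  have k4 : L * ‖ω - latticePoint β ω‖ ≤ L * (√(s : ℝ) * (β / 2)) := by gcongr
  -- Both brackets of the squared distance are at most `L √s β / 2`, and `√s L β ≤ c² γ²`.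
  refine le_of_sq_le_sq ?_ (by positivity)
  rw [norm_featureMap_sub_sq]
  nlinarith

theorem norm_projBall_le (z : H) : ‖projBall z‖ ≤ 1 := by
  have h : 0 < max 1 ‖z‖ := lt_max_of_lt_left one_pos
  rw [projBall, norm_smul, norm_inv, Real.norm_of_nonneg h.le, inv_mul_le_iff₀ h, mul_one]
  exact le_max_right _ _

/-- Triangle inequality: a point `z` outside the ball is moved by ‖z‖ - 1 ≤ ‖z‖ - ‖x‖ ≤ ‖x - z‖. -/
theorem norm_sub_projBall_le {x : H} (hx : ‖x‖ ≤ 1) (z : H) :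
    ‖x - projBall z‖ ≤ 2 * ‖x - z‖ := by
  have h : ‖z - projBall z‖ ≤ ‖x - z‖ := by
    have hz : ‖z‖ - ‖x‖ ≤ ‖x - z‖ := by rw [norm_sub_rev]; exact norm_sub_norm_le z x
    rcases le_total ‖z‖ 1 with h1 | h1
    · simp [projBall, max_eq_left h1]
    · have h0 : 0 < ‖z‖ := by linarith
      have e : z - projBall z = (1 - ‖z‖⁻¹) • z := by
        simp [projBall, max_eq_right h1, sub_smul]
      have h2 : ‖z‖⁻¹ ≤ 1 := inv_le_one_of_one_le₀ h1
      rw [e, norm_smul, Real.norm_of_nonneg (by linarith), sub_mul, inv_mul_cancel₀ h0.ne']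
      linarith
  calc ‖x - projBall z‖ = ‖(x - z) + (z - projBall z)‖ := by congr 1; abel
    _ ≤ ‖x - z‖ + ‖z - projBall z‖ := norm_add_le _ _
    _ ≤ 2 * ‖x - z‖ := by linarith

/-! ### Separating vectors obtained from a halfspace with margin -/

theorem mem_frontier_halfspace {h z : H} {d : ℝ} (hh : h ≠ 0) (hz : inner ℝ z h + d = 0) :
    z ∈ frontier (halfspace h d) := by
  rw [frontier_eq_closure_inter_closure]
  refine ⟨subset_closure (by simp [halfspace, hz]), ?_⟩
  have hcont : Continuous fun r : ℝ => z - r • h := by fun_prop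
  have ht : Filter.Tendsto (fun r : ℝ => z - r • h) (nhdsWithin 0 (Set.Ioi 0)) (nhds z) := by
    have := (hcont.tendsto 0).mono_left (nhdsWithin_le_nhds (s := Set.Ioi 0))
    simpa using this
  refine mem_closure_of_tendsto ht ?_
  filter_upwards [self_mem_nhdsWithin] with r hr
  have h1 : 0 < inner ℝ h h := real_inner_self_pos.2 hh
  have h2 : 0 < r * inner ℝ h h := mul_pos hr h1
  simp only [halfspace, Set.mem_compl_iff, Set.mem_ofPred_eq, not_le, inner_sub_left,
    real_inner_smul_left]
  linarith

theorem lt_of_notMem_enlarge {h x : H} {d γ : ℝ} (hγ : 0 < γ)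
    (hx : x ∉ enlarge γ (halfspace h d)) : inner ℝ x h + d < -(γ * ‖h‖) := by
  simp only [enlarge, Set.mem_union, not_or] at hx
  obtain ⟨h1, h2⟩ := hx
  simp only [halfspace, Set.mem_ofPred_eq, not_le] at h1
  rcases eq_or_ne h 0 with rfl | hh
  · simpa using h1
  · have hn : 0 < ‖h‖ := norm_pos_iff.2 hh
    simp only [margin, Set.mem_ofPred_eq, not_le] at h2
    set r := -(inner ℝ x h + d) / ‖h‖ with hr
    have hr0 : 0 < r := div_pos (by linarith) hn
    -- This is the foot of the perpendicular from `x` to the boundary, at distance `r`.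
    have hz : inner ℝ (x + (r / ‖h‖) • h) h + d = 0 := by
      rw [inner_add_left, real_inner_smul_left, real_inner_self_eq_norm_sq, hr]
      field_simp
      ring
    have h3 := h2.trans_le (Metric.infEDist_le_edist_of_mem (mem_frontier_halfspace hh hz))
    rw [edist_dist, dist_eq_norm] at h3
    have h4 := (ENNReal.ofReal_lt_ofReal_iff_of_nonneg hγ.le).1 h3
    rw [sub_add_cancel_left, norm_neg, norm_smul, Real.norm_of_nonneg (by positivity),
      div_mul_cancel₀ _ hn.ne', hr, lt_div_iff₀ hn] at h4
    linarith

/-- A negative point is outside the target, and it is not in the margin, so it misses the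
intersection of the enlarged halfspaces and hence one of them. -/
theorem GammaSeparates.exists_cut {t : ℕ} {X : Set H} {y : H → ℝ} {γ : ℝ} {h : Fin t → H}
    {d : Fin t → ℝ} (hs : GammaSeparates X y γ h d) (hγ : 0 < γ) {x : H} (hx : x ∈ X)
    (hy : y x = -1) : ∃ i, inner ℝ x (h i) + d i < -(γ * ‖h i‖) := by
  have h1 := (hs.1 x hx).2 hy
  have h2 : x ∉ ⋂ i, enlarge γ (halfspace (h i) (d i)) := fun h3 =>
    Set.disjoint_left.1 hs.2 ⟨h3, h1⟩ hx
  simp only [Set.mem_iInter, not_forall] at h2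
  obtain ⟨i, hi⟩ := h2
  exact ⟨i, lt_of_notMem_enlarge hγ hi⟩

/-- Moving the normalized boundary to the middle of the margin leaves γ/2 on either side. One point
of each kind in the unit ball forces |d/‖h‖ + γ/2| ≤ 1, so the shifted vector has norm at most √2,
and the factor 7/10 < 1/√2 makes it at most 1. If one side is empty, `d` is not bounded in this way,
but a constant functional suffices. -/
theorem exists_separator {γ : ℝ} (hγ : 0 < γ) (hγ2 : γ ≤ 2) (h : H) (d : ℝ) {P N : Set H}
    (hP : ∀ x ∈ P, ‖x‖ ≤ 1 ∧ 0 ≤ inner ℝ x h + d)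
    (hN : ∀ x ∈ N, ‖x‖ ≤ 1 ∧ inner ℝ x h + d < -(γ * ‖h‖)) :
    ∃ u : Aff H, ‖u‖ ≤ 1 ∧ (∀ x ∈ P, 7 / 20 * γ ≤ inner ℝ x u.fst + u.snd) ∧
      ∀ x ∈ N, inner ℝ x u.fst + u.snd ≤ -(7 / 20 * γ) := by
  have norm_le : ∀ (a : H) (b : ℝ), ‖a‖ ^ 2 + b ^ 2 ≤ 1 → ‖(WithLp.toLp 2 (a, b) : Aff H)‖ ≤ 1 := by
    intro a b hab
    refine le_of_sq_le_sq ?_ zero_le_one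
    rw [WithLp.prod_norm_sq_eq_of_L2]
    simpa using hab
  rcases N.eq_empty_or_nonempty with rfl | ⟨n, hn⟩
  · refine ⟨WithLp.toLp 2 (0, 1), norm_le _ _ (by simp), fun x _ => ?_, by simp⟩
    simp only [WithLp.toLp_fst, WithLp.toLp_snd, inner_zero_right]
    linarith
  rcases P.eq_empty_or_nonempty with rfl | ⟨p, hp⟩
  · refine ⟨WithLp.toLp 2 (0, -1), norm_le _ _ (by simp), by simp, fun x _ => ?_⟩
    simp only [WithLp.toLp_fst, WithLp.toLp_snd, inner_zero_right]
    linarith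
  obtain ⟨p1, p2⟩ := hP p hp
  obtain ⟨n1, n2⟩ := hN n hn
  have hh : h ≠ 0 := by
    rintro rfl
    simp only [inner_zero_right, norm_zero] at p2 n2
    linarith
  have h0 : 0 < ‖h‖ := norm_pos_iff.2 hh
  have q1 := abs_le.1 (abs_real_inner_le_norm p h)
  have q2 := abs_le.1 (abs_real_inner_le_norm n h)
  have r1 : ‖p‖ * ‖h‖ ≤ ‖h‖ := by nlinarith
  have r2 : ‖n‖ * ‖h‖ ≤ ‖h‖ := by nlinarith
  have key : ∀ x : H, inner ℝ x ((7 / 10 * ‖h‖⁻¹) • h) + 7 / 10 * (d / ‖h‖ + γ / 2) =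
      7 / 10 * ((inner ℝ x h + d) / ‖h‖ + γ / 2) := by
    intro x
    rw [real_inner_smul_right]
    field_simp
    ring
  refine ⟨WithLp.toLp 2 ((7 / 10 * ‖h‖⁻¹) • h, 7 / 10 * (d / ‖h‖ + γ / 2)), ?_, ?_, ?_⟩
  · refine norm_le _ _ ?_
    have e1 : -1 ≤ d / ‖h‖ := by rw [le_div_iff₀ h0]; linarith
    have e2 : d / ‖h‖ ≤ 1 - γ := by rw [div_le_iff₀ h0]; nlinarith
    rw [norm_smul, Real.norm_of_nonneg (by positivity), mul_assoc, inv_mul_cancel₀ h0.ne']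
    nlinarith
  · intro x hx
    simp only [WithLp.toLp_fst, WithLp.toLp_snd, key]
    have := div_nonneg (hP x hx).2 h0.le
    linarith
  · intro x hx
    simp only [WithLp.toLp_fst, WithLp.toLp_snd, key]
    have : (inner ℝ x h + d) / ‖h‖ ≤ -γ := by
      rw [div_le_iff₀ h0]
      linarith [(hN x hx).2]
    linarith

end RKHSPoly

namespace RKHSPoly

variable {s : ℕ} {H : Type*} [NormedAddCommGroup H] [InnerProductSpace ℝ H]

/-! ### One update of the LP algorithm -/

theorem norm_combine_sq (a : ℝ) (u v : Aff H) :
    ‖Impl.combine a u v‖ ^ 2 =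
      ‖v‖ ^ 2 - 2 * a * inner ℝ v (v - u) + a ^ 2 * ‖v - u‖ ^ 2 := by
  have e : Impl.combine a u v = v - a • (v - u) := by
    simp only [Impl.combine, smul_sub, sub_smul, one_smul]
    abel
  rw [e, @norm_sub_sq_real, norm_smul, mul_pow, Real.norm_eq_abs, sq_abs, real_inner_smul_right]
  ring

/-- The bounds kept by the nonempty states of the LP algorithm. -/
def Bounded (γ : ℝ) (u : Aff H) : Prop := γ / 4 < ‖u‖ ∧ ‖u‖ ^ 2 ≤ 2

/-- The next state of the LP algorithm when `v` is the constraint vector used. -/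
noncomputable def advance (β : ℝ) : State H → Aff H → State H
  | none, v => some v
  | some u, v => some (Impl.combine (β * (⌊Impl.projCoeff u v / β⌋ : ℝ)) u v)

/-- The potential that grows by at least one with every update. -/
noncomputable def energy : State H → ℝ
  | none => 0
  | some u => 16 / ‖u‖ ^ 2

omit [InnerProductSpace ℝ H] in
theorem energy_nonneg (S : State H) : 0 ≤ energy S := by
  cases S <;> simp only [energy]
  · exact le_rfl
  · positivity

omit [InnerProductSpace ℝ H] in
theorem energy_le {γ : ℝ} (hγ : 0 < γ) {S : State H} (hS : ∀ u ∈ S, Bounded γ u) :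
    energy S ≤ 256 / γ ^ 2 := by
  cases S with
  | none => simp only [energy]; positivity
  | some u =>
    have h := (hS u rfl).1
    have h2 : (γ / 4) ^ 2 ≤ ‖u‖ ^ 2 := by gcongr
    simp only [energy]
    calc 16 / ‖u‖ ^ 2 ≤ 16 / (γ / 4) ^ 2 := by gcongr
      _ = 256 / γ ^ 2 := by field_simp; norm_num

/-- Here `U`, `V`, `p` stand for ‖u‖², ‖v‖², ⟨u, v⟩. The exact projection raises the energy by 2,
and rounding its coefficient loses at most 1. -/
theorem rounded_step_bounds {γ β U V p α a : ℝ} (hγ : 0 < γ) (hβ : 0 < β)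
    (hβγ : β ≤ γ ^ 2 / 200) (hU : γ ^ 2 / 16 < U) (hU2 : U ≤ 2) (hV : 1 ≤ V) (hV2 : V ≤ 2)
    (hp : p ≤ U / 2) (hp2 : -2 ≤ p) (hα : α * (U + V - 2 * p) = V - p)
    (ha : a ≤ α) (ha2 : α - a < β)
    (hW : γ ^ 2 / 16 < V - 2 * α * (V - p) + α ^ 2 * (U + V - 2 * p)) :
    γ ^ 2 / 16 < V - 2 * a * (V - p) + a ^ 2 * (U + V - 2 * p) ∧
    16 / U + 1 ≤ 16 / (V - 2 * a * (V - p) + a ^ 2 * (U + V - 2 * p)) := by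
  set D := U + V - 2 * p with hD
  set W := V - 2 * α * (V - p) + α ^ 2 * D with hWd
  set U' := V - 2 * a * (V - p) + a ^ 2 * D with hU'
  have hD1 : 1 ≤ D := by linarith
  have hD8 : D ≤ 8 := by linarith
  -- The coefficient `α` minimizes the quadratic, so there is no linear term.
  have hU'W : U' = W + (α - a) ^ 2 * D := by
    rw [hU', hWd, ← hα]; ring
  -- Gram determinant: `W` is the squared distance of the origin from the line through `u` and `v`.
  have hWD : W * D = U * V - p ^ 2 := by
    have : W * D = V * D - (α * D) ^ 2 + (α * D - (V - p)) * (2 * (α * D)) := by rw [hWd]; ring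
    rw [this, hα]
    rw [hD]; ring
  have g2 : 0 < γ ^ 2 := by positivity
  have hW0 : 0 < W := by linarith
  have hsq : (α - a) ^ 2 ≤ β ^ 2 := by
    have : 0 ≤ α - a := by linarith
    gcongr
  have hnn : 0 ≤ (α - a) ^ 2 * D := by positivity
  have hU0 : 0 < U := by linarith
  have hU'0 : 0 < U' := by linarith
  refine ⟨by linarith, ?_⟩
  have k1 : W * (8 + U) ≤ 8 * U := by
    have : W * (8 + U) * D ≤ 8 * U * D := by
      rw [show W * (8 + U) * D = W * D * (8 + U) by ring, hWD, hD]
      have t1 : U / 2 ≤ U - p := by linarith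
      have t2 : (U / 2) ^ 2 ≤ (U - p) ^ 2 := by gcongr
      have t3 : 0 ≤ U * p ^ 2 := by positivity
      have t4 : U ^ 2 * V ≤ U ^ 2 * 2 := by gcongr
      nlinarith
    exact le_of_mul_le_mul_right this (by linarith)
  have k2 : 1 / U + 1 / 8 ≤ 1 / W := by
    rw [div_add_div _ _ hU0.ne' (by norm_num), div_le_div_iff₀ (by positivity) hW0]
    linarith
  -- This amounts to 16(U' - W) ≤ W U'. The left side is at most 128 β² and the right side at least
  -- γ⁴/256, which is where β ≤ γ²/200 enters.
  have k3 : 16 / W - 1 ≤ 16 / U' := by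
    rw [div_sub_one hW0.ne', div_le_div_iff₀ hW0 hU'0]
    have t1 : (γ ^ 2 / 16) * (γ ^ 2 / 16) ≤ W * U' := by
      have : γ ^ 2 / 16 ≤ U' := by linarith
      gcongr
    have t2 : (α - a) ^ 2 * D ≤ β ^ 2 * 8 := by gcongr
    have t3 : β ^ 2 ≤ (γ ^ 2 / 200) ^ 2 := by gcongr
    have t4 : 0 ≤ (γ ^ 2) ^ 2 := by positivity
    nlinarith
  have e1 : 16 / U = 16 * (1 / U) := by ring
  have e2 : 16 / W = 16 * (1 / W) := by ring
  rw [e1]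
  rw [e2] at k3
  linarith

theorem projCoeff_mem_Icc {u v : Aff H} (hv : inner ℝ u v ≤ ‖v‖ ^ 2)
    (hu : inner ℝ u v ≤ ‖u‖ ^ 2) : Impl.projCoeff u v ∈ Set.Icc (0 : ℝ) 1 := by
  have h1 : inner ℝ v (v - u) = ‖v‖ ^ 2 - inner ℝ u v := by
    rw [inner_sub_right, real_inner_self_eq_norm_sq, real_inner_comm]
  have h2 : ‖v - u‖ ^ 2 = ‖v‖ ^ 2 - 2 * inner ℝ u v + ‖u‖ ^ 2 := by
    rw [@norm_sub_sq_real, real_inner_comm]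
  rw [Impl.projCoeff, h1, h2]
  have h3 : 0 ≤ ‖v‖ ^ 2 - inner ℝ u v := by linarith
  exact ⟨div_nonneg h3 (by linarith), div_le_one_of_le₀ (by linarith) (by linarith)⟩

theorem mul_floor_mem_Icc {α β : ℝ} (hβ : 0 < β) (hα : 0 ≤ α) :
    0 ≤ β * (⌊α / β⌋ : ℝ) ∧ β * (⌊α / β⌋ : ℝ) ≤ α ∧ α - β * (⌊α / β⌋ : ℝ) < β := by
  have h1 : (0 : ℝ) ≤ (⌊α / β⌋ : ℝ) := by exact_mod_cast Int.floor_nonneg.2 (by positivity)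
  have h2 := Int.floor_le (α / β)
  have h3 := Int.lt_floor_add_one (α / β)
  rw [le_div_iff₀ hβ] at h2
  rw [div_lt_iff₀ hβ] at h3
  exact ⟨by positivity, by linarith, by linarith⟩

theorem combine_rounded {γ β : ℝ} (hγ : 0 < γ) (hβ : 0 < β) (hβγ : β ≤ γ ^ 2 / 200) {u v : Aff H}
    (hu : Bounded γ u) (hv : 1 ≤ ‖v‖ ^ 2) (hv2 : ‖v‖ ^ 2 ≤ 2) (huv : inner ℝ u v ≤ ‖u‖ ^ 2 / 2)
    (hw : γ / 4 < ‖Impl.combine (Impl.projCoeff u v) u v‖) :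
    Bounded γ (Impl.combine (β * (⌊Impl.projCoeff u v / β⌋ : ℝ)) u v) ∧
      energy (some u) + 1 ≤
        energy (some (Impl.combine (β * (⌊Impl.projCoeff u v / β⌋ : ℝ)) u v)) := by
  obtain ⟨hu1, hu2⟩ := hu
  have hsq : ∀ x : Aff H, γ / 4 < ‖x‖ ↔ γ ^ 2 / 16 < ‖x‖ ^ 2 := by
    intro x
    rw [← pow_lt_pow_iff_left₀ (by positivity) (norm_nonneg x) two_ne_zero, div_pow]
    norm_num
  have h0 : 0 ≤ Impl.projCoeff u v := (projCoeff_mem_Icc (by linarith)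
    (by linarith [sq_nonneg ‖u‖])).1
  set α := Impl.projCoeff u v with hα
  obtain ⟨-, a1, a2⟩ := mul_floor_mem_Icc hβ h0
  set a := β * (⌊α / β⌋ : ℝ)
  have h1 : inner ℝ v (v - u) = ‖v‖ ^ 2 - inner ℝ u v := by
    rw [inner_sub_right, real_inner_self_eq_norm_sq, real_inner_comm]
  have h2 : ‖v - u‖ ^ 2 = ‖u‖ ^ 2 + ‖v‖ ^ 2 - 2 * inner ℝ u v := by
    rw [@norm_sub_sq_real, real_inner_comm]; ring
  have hp2 : -2 ≤ inner ℝ u v := by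
    have := (abs_le.1 (abs_real_inner_le_norm u v)).1
    nlinarith [sq_nonneg (‖u‖ - ‖v‖)]
  have hα' : α * (‖u‖ ^ 2 + ‖v‖ ^ 2 - 2 * inner ℝ u v) = ‖v‖ ^ 2 - inner ℝ u v := by
    rw [hα, Impl.projCoeff, h1, h2, div_mul_cancel₀]
    nlinarith [sq_nonneg ‖u‖]
  rw [hsq] at hu1 hw
  rw [norm_combine_sq, h1, h2] at hw
  obtain ⟨b1, b2⟩ := rounded_step_bounds hγ hβ hβγ hu1 hu2 hv hv2 huv hp2 hα' a1 a2 hw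
  have e := norm_combine_sq a u v
  rw [h1, h2] at e
  rw [← e] at b1 b2
  refine ⟨⟨(hsq _).2 b1, ?_⟩, b2⟩
  have g2 : 0 < γ ^ 2 := by positivity
  have c1 : 0 < ‖u‖ ^ 2 := by linarith
  have c2 : 0 < ‖Impl.combine a u v‖ ^ 2 := by linarith
  -- The energy has grown, so the norm has not, and the upper bound 2 persists.
  have c3 : 16 / ‖u‖ ^ 2 ≤ 16 / ‖Impl.combine a u v‖ ^ 2 := by linarith
  rw [div_le_div_iff_of_pos_left (by norm_num) c1 c2] at c3
  linarith

namespace Impl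

variable {I : Impl s H} {Ω : Set (Euc s)}

/-- The standing assumptions on an implementation, with explicit constants. -/
structure Regular (I : Impl s H) (Ω : Set (Euc s)) : Prop where
  norm_le : ∀ ω ∈ Ω, ‖I.φ ω‖ ≤ 1
  label : ∀ ω ∈ Ω, I.y (I.φ ω) = 1 ∨ I.y (I.φ ω) = -1
  γ_pos : 0 < I.γ
  γ_le : I.γ ≤ 2
  β_pos : 0 < I.β
  β_le : I.β ≤ I.γ ^ 2 / 200
  approx : ∀ ω ∈ Ω, ‖I.φ ω - I.φ (latticePoint I.β ω)‖ ≤ I.γ / 200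

theorem inner_vec (I : Impl s H) (ω : Euc s) (u : Aff H) :
    inner ℝ u (I.vec ω) =
      I.y (I.φ ω) * (inner ℝ (projBall (I.φ (latticePoint I.β ω))) u.fst + u.snd) := by
  rw [WithLp.prod_inner_apply, real_inner_comm u.fst]
  simp only [vec, WithLp.ofLp_toLp, Prod.smul_fst, Prod.smul_snd, real_inner_smul_right,
    smul_eq_mul, mul_one, RCLike.inner_apply, conj_trivial, WithLp.ofLp_fst, WithLp.ofLp_snd]
  ring

omit [InnerProductSpace ℝ H] in
theorem norm_fst_le (u : Aff H) : ‖u.fst‖ ≤ ‖u‖ := by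
  refine le_of_sq_le_sq ?_ (norm_nonneg _)
  rw [WithLp.prod_norm_sq_eq_of_L2]
  nlinarith [sq_nonneg ‖u.snd‖]

theorem Regular.abs_inner_vec_sub_le (hI : I.Regular Ω) {ω : Euc s} (hω : ω ∈ Ω) (u : Aff H) :
    |inner ℝ u (I.vec ω) - I.y (I.φ ω) * (inner ℝ (I.φ ω) u.fst + u.snd)| ≤
      I.γ / 100 * ‖u‖ := by
  have h1 : inner ℝ u (I.vec ω) - I.y (I.φ ω) * (inner ℝ (I.φ ω) u.fst + u.snd) =
      I.y (I.φ ω) * -inner ℝ (I.φ ω - projBall (I.φ (latticePoint I.β ω))) u.fst := by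
    rw [inner_vec, inner_sub_left]; ring
  have h2 : |I.y (I.φ ω)| = 1 := by
    rcases hI.label ω hω with h | h <;> simp [h]
  rw [h1, abs_mul, h2, one_mul, abs_neg]
  refine (abs_real_inner_le_norm _ _).trans ?_
  have h3 := norm_sub_projBall_le (hI.norm_le ω hω) (I.φ (latticePoint I.β ω))
  have h4 := hI.approx ω hω
  have h5 : ‖I.φ ω - projBall (I.φ (latticePoint I.β ω))‖ ≤ I.γ / 100 := by linarith
  have h6 := norm_fst_le u
  have := hI.γ_pos
  gcongr

theorem Regular.norm_vec_sq (hI : I.Regular Ω) {ω : Euc s} (hω : ω ∈ Ω) :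
    1 ≤ ‖I.vec ω‖ ^ 2 ∧ ‖I.vec ω‖ ^ 2 ≤ 2 := by
  have h := norm_projBall_le (I.φ (latticePoint I.β ω))
  have h0 := norm_nonneg (projBall (I.φ (latticePoint I.β ω)))
  rw [WithLp.prod_norm_sq_eq_of_L2]
  rcases hI.label ω hω with h2 | h2 <;> simp [vec, h2] <;> nlinarith

theorem Regular.bounded_vec (hI : I.Regular Ω) {ω : Euc s} (hω : ω ∈ Ω) :
    Bounded I.γ (I.vec ω) := by
  obtain ⟨h1, h2⟩ := hI.norm_vec_sq hω
  refine ⟨?_, h2⟩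
  have := hI.γ_le
  nlinarith [norm_nonneg (I.vec ω)]

/-- Violation is tested on the original point, so the product with the discretized vector may be
positive. It is at most γ‖u‖/100, which is below ‖u‖²/2 because ‖u‖ > γ/4. -/
theorem Regular.inner_vec_le (hI : I.Regular Ω) {ω : Euc s} (hω : ω ∈ Ω) {u : Aff H}
    (hu : Bounded I.γ u) (h : I.y (I.φ ω) * (inner ℝ (I.φ ω) u.fst + u.snd) ≤ 0) :
    inner ℝ u (I.vec ω) ≤ ‖u‖ ^ 2 / 2 := by
  have h1 := (abs_le.1 (hI.abs_inner_vec_sub_le hω u)).2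
  have h2 := hu.1
  have h3 := hI.γ_pos
  nlinarith

/-! ### Runs of the LP algorithm -/

theorem mem_violated {A : Finset (Euc s)} {u : Aff H} {ω : Euc s} :
    ω ∈ I.violated A u ↔ ω ∈ A ∧ I.y (I.φ ω) * (inner ℝ (I.φ ω) u.fst + u.snd) ≤ 0 := by
  simp [violated]

/-- The states that can be reached by processing points of `X`: they are determined by a short
list of points. -/
def Derived (I : Impl s H) (X : Finset (Euc s)) (S : State H) : Prop :=
  (∀ u ∈ S, Bounded I.γ u) ∧ ∃ l : List (Euc s), (∀ ω ∈ l, ω ∈ X) ∧ (l.length : ℝ) ≤ energy S ∧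
    S = (l.map I.vec).foldl (advance I.β) none

theorem derived_none (X : Finset (Euc s)) : I.Derived X none :=
  ⟨by simp, [], by simp, by simp [energy], rfl⟩

/-- One iteration that neither stops nor fails is an update, and it increases the energy. -/
theorem Regular.lpStep_active (hI : I.Regular Ω) {X A : Finset (Euc s)} (hX : (X : Set _) ⊆ Ω)
    (hA : A ⊆ X) (hne : A.Nonempty) {S S' : State H} (hS : I.Derived X S)
    (h : I.lpStep A (.active S) = .active S') :
    I.Derived X S' ∧ energy S + 1 ≤ energy S' ∧ ∃ u, S' = some u := by
  obtain ⟨hb, l, hl, hlen, hfold⟩ := hS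
  have main : ∀ ω ∈ X, S' = advance I.β S (I.vec ω) → energy S + 1 ≤ energy S' →
      (∀ u ∈ S', Bounded I.γ u) → I.Derived X S' := by
    intro ω hω e he hbd
    refine ⟨hbd, l ++ [ω], ?_, ?_, ?_⟩
    · intro x hx
      rcases List.mem_append.1 hx with h | h
      · exact hl x h
      · rw [List.mem_singleton.1 h]; exact hω
    · push_cast [List.length_append, List.length_singleton]
      linarith
    · rw [List.map_append, List.foldl_append, ← hfold, e]
      rfl
  cases S with
  | none =>
    simp only [lpStep, LPConfig.active.injEq] at h
    subst h
    have hm := hA (I.pick_mem A hne)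
    obtain ⟨n1, n2⟩ := hI.norm_vec_sq (hX hm)
    have he : energy (none : State H) + 1 ≤ energy (some (I.vec (I.pick A))) := by
      simp only [energy]
      rw [zero_add, le_div_iff₀ (by linarith)]
      linarith
    refine ⟨main _ hm rfl he ?_, he, _, rfl⟩
    rintro u ⟨⟩
    exact hI.bounded_vec (hX hm)
  | some u =>
    simp only [lpStep] at h
    split_ifs at h with h1 h2
    simp only [LPConfig.active.injEq] at h
    subst h
    have hv := I.pick_mem _ (Finset.nonempty_iff_ne_empty.2 h1)
    obtain ⟨v1, v2⟩ := mem_violated.1 hv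
    have hm := hA v1
    obtain ⟨n1, n2⟩ := hI.norm_vec_sq (hX hm)
    have hu := hb u rfl
    obtain ⟨c1, c2⟩ := combine_rounded hI.γ_pos hI.β_pos hI.β_le hu n1 n2
      (hI.inner_vec_le (hX hm) hu v2) (not_le.1 h2)
    refine ⟨main _ hm rfl c2 ?_, c2, _, rfl⟩
    rintro u' ⟨⟩
    exact c1

theorem lpStep_found {A : Finset (Euc s)} {S : State H} {u : Aff H}
    (h : I.lpStep A (.active S) = .found u) : S = some u ∧ I.violated A u = ∅ := by
  cases S with
  | none => simp [lpStep] at h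
  | some u' =>
    simp only [lpStep] at h
    split_ifs at h with h1
    simp only [LPConfig.found.injEq] at h
    subst h
    exact ⟨rfl, h1⟩

/-- With a vector of functional margin greater than `γ / 4` the algorithm does not fail. -/
theorem Regular.lpStep_separated (hI : I.Regular Ω) {A : Finset (Euc s)} (hA : (A : Set _) ⊆ Ω)
    (hne : A.Nonempty) {S : State H} (hb : ∀ u ∈ S, Bounded I.γ u) {z : Aff H} (hz : ‖z‖ ≤ 1)
    (hzA : ∀ ω ∈ A, I.γ / 4 < inner ℝ z (I.vec ω)) (hzS : ∀ u ∈ S, I.γ / 4 < inner ℝ z u) :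
    I.lpStep A (.active S) ≠ .report ∧
      ∀ S', I.lpStep A (.active S) = .active S' → ∀ u ∈ S', I.γ / 4 < inner ℝ z u := by
  cases S with
  | none =>
    simp only [lpStep, ne_eq, reduceCtorEq, not_false_eq_true, LPConfig.active.injEq, true_and]
    rintro S' rfl u ⟨⟩
    exact hzA _ (I.pick_mem A hne)
  | some u =>
    by_cases h1 : I.violated A u = ∅
    · simp [lpStep, h1]
    have hv := I.pick_mem _ (Finset.nonempty_iff_ne_empty.2 h1)
    set ω := I.pick (I.violated A u) with hω
    obtain ⟨v1, v2⟩ := mem_violated.1 hv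
    have hu := hb u rfl
    have hp := hI.inner_vec_le (hA v1) hu v2
    have hα := projCoeff_mem_Icc (u := u) (v := I.vec ω)
      (by linarith [(hI.norm_vec_sq (hA v1)).1, hu.2]) (by linarith [sq_nonneg ‖u‖])
    -- Used twice: with the exact coefficient it refutes failure, by Cauchy–Schwarz and ‖z‖ ≤ 1;
    -- with the rounded one it passes the margin on to the next state.
    have key : ∀ a : ℝ, 0 ≤ a → a ≤ 1 → I.γ / 4 < inner ℝ z (combine a u (I.vec ω)) := by
      intro a a0 a1
      rw [combine, inner_add_right, real_inner_smul_right, real_inner_smul_right]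
      have b1 := hzA ω v1
      have b2 := hzS u rfl
      rcases a0.eq_or_lt with rfl | a0
      · linarith
      · nlinarith
    have h2 : ¬ ‖combine (projCoeff u (I.vec ω)) u (I.vec ω)‖ ≤ I.γ / 4 := by
      have k := key _ hα.1 hα.2
      have k2 := (abs_le.1 (abs_real_inner_le_norm z
        (combine (projCoeff u (I.vec ω)) u (I.vec ω)))).2
      have k3 := norm_nonneg (combine (projCoeff u (I.vec ω)) u (I.vec ω))
      rw [not_le]
      nlinarith
    simp only [lpStep, h1, if_false, ← hω, h2]
    simp only [ne_eq, reduceCtorEq, not_false_eq_true, LPConfig.active.injEq, true_and]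
    rintro S' rfl u' ⟨⟩
    obtain ⟨a1, a2, -⟩ := mul_floor_mem_Icc hI.β_pos hα.1
    exact key _ a1 (a2.trans hα.2)

theorem lpRun_succ (I : Impl s H) (S : State H) (A : Finset (Euc s)) (n : ℕ) :
    I.lpRun S A (n + 1) = (I.lpStep A)^[n] (I.lpStep A (.active S)) := rfl

theorem iterate_lpStep_found (I : Impl s H) (A : Finset (Euc s)) (u : Aff H) (n : ℕ) :
    (I.lpStep A)^[n] (.found u) = .found u := Function.iterate_fixed rfl n

theorem iterate_lpStep_report (I : Impl s H) (A : Finset (Euc s)) (n : ℕ) :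
    (I.lpStep A)^[n] .report = .report := Function.iterate_fixed rfl n

/-- A run that is still active after `n` iterations has increased the energy by `n`. -/
theorem Regular.lpRun_active (hI : I.Regular Ω) {X A : Finset (Euc s)} (hX : (X : Set _) ⊆ Ω)
    (hA : A ⊆ X) (hne : A.Nonempty) (n : ℕ) :
    ∀ {S S' : State H}, I.Derived X S → I.lpRun S A n = .active S' →
      I.Derived X S' ∧ energy S + n ≤ energy S' := by
  induction n with
  | zero =>
    intro S S' hS h
    simp only [lpRun, Function.iterate_zero, id, LPConfig.active.injEq] at h
    subst h
    exact ⟨hS, by simp⟩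
  | succ n ih =>
    intro S S' hS h
    rw [lpRun_succ] at h
    cases hc : I.lpStep A (.active S) with
    | active S₁ =>
      rw [hc] at h
      obtain ⟨d1, e1, -⟩ := hI.lpStep_active hX hA hne hS hc
      obtain ⟨d2, e2⟩ := ih d1 h
      refine ⟨d2, ?_⟩
      push_cast
      linarith
    | found u => rw [hc, iterate_lpStep_found] at h; cases h
    | report => rw [hc, iterate_lpStep_report] at h; cases h

theorem Regular.lpHaltsWithin (hI : I.Regular Ω) {X A : Finset (Euc s)} (hX : (X : Set _) ⊆ Ω)
    (hA : A ⊆ X) (hne : A.Nonempty) {S : State H} (hS : I.Derived X S) {N : ℝ}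
    (hN : 256 / I.γ ^ 2 + 1 ≤ N) : I.LPHaltsWithin N S A := by
  have hγ := hI.γ_pos
  have h0 : (0 : ℝ) ≤ 256 / I.γ ^ 2 := by positivity
  -- One iteration more than the energy bound allows for an active run.
  refine ⟨⌊256 / I.γ ^ 2⌋₊ + 1, ?_, fun S' h => ?_⟩
  · push_cast
    linarith [Nat.floor_le h0]
  · obtain ⟨d, e⟩ := hI.lpRun_active hX hA hne _ hS h
    have h1 := energy_le hγ d.1
    have h2 := energy_nonneg S
    have h3 := Nat.lt_floor_add_one (256 / I.γ ^ 2)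
    push_cast at e
    linarith

/-- A run that stops at a feasible solution. -/
theorem Regular.lpRun_found (hI : I.Regular Ω) {X A : Finset (Euc s)} (hX : (X : Set _) ⊆ Ω)
    (hA : A ⊆ X) (hne : A.Nonempty) (n : ℕ) :
    ∀ {S : State H} {u : Aff H}, I.Derived X S → I.lpRun S A n = .found u →
      I.Derived X (some u) ∧ I.violated A u = ∅ ∧
        (S = some u ∨ energy S + 1 ≤ energy (some u)) := by
  induction n with
  | zero => intro S u _ h; simp [lpRun] at h
  | succ n ih =>
    intro S u hS h
    rw [lpRun_succ] at h
    cases hc : I.lpStep A (.active S) with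
    | active S₁ =>
      rw [hc] at h
      obtain ⟨d1, e1, -⟩ := hI.lpStep_active hX hA hne hS hc
      obtain ⟨d2, v2, e2⟩ := ih d1 h
      refine ⟨d2, v2, Or.inr ?_⟩
      rcases e2 with rfl | e2
      · exact e1
      · linarith
    | found u' =>
      rw [hc, iterate_lpStep_found] at h
      simp only [LPConfig.found.injEq] at h
      subst h
      obtain ⟨rfl, hv⟩ := lpStep_found hc
      exact ⟨hS, hv, Or.inl rfl⟩
    | report => rw [hc, iterate_lpStep_report] at h; cases h

theorem Regular.lpRun_separated (hI : I.Regular Ω) {X A : Finset (Euc s)} (hX : (X : Set _) ⊆ Ω)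
    (hA : A ⊆ X) (hne : A.Nonempty) {z : Aff H} (hz : ‖z‖ ≤ 1)
    (hzA : ∀ ω ∈ A, I.γ / 4 < inner ℝ z (I.vec ω)) (n : ℕ) :
    ∀ {S : State H}, I.Derived X S → (∀ u ∈ S, I.γ / 4 < inner ℝ z u) →
      I.lpRun S A n ≠ .report ∧ ∀ u, I.lpRun S A n = .found u → I.γ / 4 < inner ℝ z u := by
  induction n with
  | zero => intro S _ _; simp [lpRun]
  | succ n ih =>
    intro S hS hzS
    obtain ⟨h1, h2⟩ := hI.lpStep_separated (fun ω hω => hX (hA hω)) hne hS.1 hz hzA hzS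
    rw [lpRun_succ]
    cases hc : I.lpStep A (.active S) with
    | active S₁ => exact ih (hI.lpStep_active hX hA hne hS hc).1 (h2 _ hc)
    | found u' =>
      rw [iterate_lpStep_found]
      obtain ⟨rfl, -⟩ := lpStep_found hc
      refine ⟨by simp, ?_⟩
      rintro u ⟨⟩
      exact hzS _ rfl
    | report => exact absurd hc h1

theorem exists_lpRun_of_lpOut {S : State H} {A : Finset (Euc s)} {u : Aff H}
    (h : I.lpOut S A = some u) : ∃ n, I.lpRun S A n = .found u := by
  unfold lpOut at h
  split_ifs at h with h1
  simp only [Option.some.injEq] at h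
  rw [← h]
  exact h1.choose_spec

/-- A run that halts without reporting failure has found a solution. Since `lpOut` chooses some
solution occurring in the run, the margin is established at an arbitrary iteration. -/
theorem Regular.exists_lpOut (hI : I.Regular Ω) {X A : Finset (Euc s)} (hX : (X : Set _) ⊆ Ω)
    (hA : A ⊆ X) (hne : A.Nonempty) {z : Aff H} (hz : ‖z‖ ≤ 1)
    (hzA : ∀ ω ∈ A, I.γ / 4 < inner ℝ z (I.vec ω)) {S : State H} (hS : I.Derived X S)
    (hzS : ∀ u ∈ S, I.γ / 4 < inner ℝ z u) :
    ∃ u, I.lpOut S A = some u ∧ I.γ / 4 < inner ℝ z u := by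
  obtain ⟨n, -, hn⟩ := hI.lpHaltsWithin hX hA hne hS le_rfl
  have hsep := hI.lpRun_separated hX hA hne hz hzA n hS hzS
  have hex : ∃ u : Aff H, ∃ n : ℕ, I.lpRun S A n = .found u := by
    cases hc : I.lpRun S A n with
    | active S' => exact absurd hc (hn S')
    | found u => exact ⟨u, n, hc⟩
    | report => exact absurd hc hsep.1
  have ho : I.lpOut S A = some hex.choose := dif_pos hex
  obtain ⟨k, hk⟩ := hex.choose_spec
  exact ⟨_, ho, (hI.lpRun_separated hX hA hne hz hzA k hS hzS).2 _ hk⟩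

end Impl

end RKHSPoly

namespace RKHSPoly

variable {s : ℕ} {H : Type*} [NormedAddCommGroup H] [InnerProductSpace ℝ H]

namespace Impl

variable {I : Impl s H} {Ω : Set (Euc s)} {X : Finset (Euc s)}

/-! ### Nodes of the search trees -/

/-- The properties shared by all nodes of both search trees on the sample `X`. -/
structure NodeInv (I : Impl s H) (X : Finset (Euc s)) (n : Node s H) : Prop where
  pos_subset : I.pos X ⊆ n.1
  subset : n.1 ⊆ X
  derived : I.Derived X n.2
  feasible : ∀ u ∈ n.2, I.violated n.1 u = ∅

omit [NormedAddCommGroup H] [InnerProductSpace ℝ H] in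
theorem mem_pos {ω : Euc s} : ω ∈ I.pos X ↔ ω ∈ X ∧ I.y (I.φ ω) = 1 := by
  simp [pos]

omit [NormedAddCommGroup H] [InnerProductSpace ℝ H] in
theorem mem_neg {ω : Euc s} : ω ∈ I.neg X ↔ ω ∈ X ∧ I.y (I.φ ω) = -1 := by
  simp [neg]

theorem nodeInv_root (I : Impl s H) (X : Finset (Euc s)) : I.NodeInv X (I.pos X, none) :=
  ⟨subset_rfl, fun _ h => (mem_pos.1 h).1, derived_none X, by simp⟩

theorem mem_region_some {z : H} {u : Aff H} :
    z ∈ State.region (some u) ↔ 0 ≤ inner ℝ z u.fst + u.snd := Iff.rfl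

theorem NodeInv.pos_mem_region {n : Node s H} (hn : I.NodeInv X n) {ω : Euc s}
    (hω : ω ∈ I.pos X) : I.φ ω ∈ n.2.region := by
  obtain ⟨A, S⟩ := n
  cases S with
  | none => exact Set.mem_univ _
  | some u =>
    have h1 := hn.feasible u rfl
    have h2 : ω ∉ I.violated A u := by rw [h1]; simp
    rw [mem_violated, not_and, (mem_pos.1 hω).2, one_mul, not_le] at h2
    exact mem_region_some.2 (h2 (hn.pos_subset hω)).le

theorem mem_child {n n' : Node s H} {ω : Euc s} :
    n' ∈ I.child n ω ↔ ∃ u, I.lpOut n.2 (insert ω n.1) = some u ∧ n' = (insert ω n.1, some u) := by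
  unfold child
  cases I.lpOut n.2 (insert ω n.1) <;> simp

theorem card_child_le (n : Node s H) (ω : Euc s) : (I.child n ω).card ≤ 1 := by
  unfold child
  split <;> simp

theorem Regular.nodeInv_child (hI : I.Regular Ω) (hX : (X : Set _) ⊆ Ω) {n n' : Node s H}
    (hn : I.NodeInv X n) {ω : Euc s} (hω : ω ∈ X) (h : n' ∈ I.child n ω) : I.NodeInv X n' := by
  obtain ⟨u, hu, rfl⟩ := mem_child.1 h
  obtain ⟨k, hk⟩ := exists_lpRun_of_lpOut hu
  have hA : insert ω n.1 ⊆ X := Finset.insert_subset hω hn.subset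
  obtain ⟨d, v, -⟩ := hI.lpRun_found hX hA (Finset.insert_nonempty _ _) k hn.derived hk
  refine ⟨hn.pos_subset.trans (Finset.subset_insert _ _), hA, d, ?_⟩
  rintro u' ⟨⟩
  exact v

/-- The parent state accepts the negative point, so it violates the new constraint and cannot be
returned unchanged: at least one update took place. -/
theorem Regular.energy_child (hI : I.Regular Ω) (hX : (X : Set _) ⊆ Ω) {n n' : Node s H}
    (hn : I.NodeInv X n) {ω : Euc s} (hω : ω ∈ I.neg X) (hr : I.φ ω ∈ n.2.region)
    (h : n' ∈ I.child n ω) : energy n.2 + 1 ≤ energy n'.2 := by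
  obtain ⟨u, hu, rfl⟩ := mem_child.1 h
  obtain ⟨k, hk⟩ := exists_lpRun_of_lpOut hu
  obtain ⟨hωX, hy⟩ := mem_neg.1 hω
  have hA : insert ω n.1 ⊆ X := Finset.insert_subset hωX hn.subset
  obtain ⟨-, v, e⟩ := hI.lpRun_found hX hA (Finset.insert_nonempty _ _) k hn.derived hk
  refine e.resolve_left fun e => ?_
  rw [e, mem_region_some] at hr
  have h2 : ω ∈ I.violated (insert ω n.1) u :=
    mem_violated.2 ⟨Finset.mem_insert_self _ _, by rw [hy]; linarith⟩
  rw [v] at h2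
  simp at h2

theorem mem_poly {G : Finset (Node s H)} {z : H} : z ∈ poly G ↔ ∀ n ∈ G, z ∈ n.2.region := by
  simp [poly]

/-- Every region contains all positive sample points, so an intersection of regions can only err by
accepting a negative one. -/
theorem exists_neg_of_misclassified {G : Finset (Node s H)} (hG : ∀ n ∈ G, I.NodeInv X n)
    {ω : Euc s} (hω : ω ∈ X) (h : ¬ CorrectlyClassifies I.y (poly G) (I.φ ω)) :
    ω ∈ I.neg X ∧ ∀ n ∈ G, I.φ ω ∈ n.2.region := by
  rw [CorrectlyClassifies, not_and_or] at h
  rcases h with h | h <;> simp only [Classical.not_imp, not_not] at h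
  · refine absurd (mem_poly.2 fun n hn => ?_) h.2
    exact (hG n hn).pos_mem_region (mem_pos.2 ⟨hω, h.1⟩)
  · exact ⟨mem_neg.2 ⟨hω, h.1⟩, mem_poly.1 h.2⟩

/-- The labels on `Ω` are separated by `t` vectors of functional margin greater than `γ / 4`: every
negative point is cut off by one of them. -/
def Separable (I : Impl s H) (Ω : Set (Euc s)) (t : ℕ) : Prop :=
  ∃ z : Fin t → Aff H, (∀ i, ‖z i‖ ≤ 1) ∧
    (∀ ω ∈ Ω, I.y (I.φ ω) = 1 → ∀ i, I.γ / 4 < inner ℝ (z i) (I.vec ω)) ∧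
    ∀ ω ∈ Ω, I.y (I.φ ω) = -1 → ∃ i, I.γ / 4 < inner ℝ (z i) (I.vec ω)

theorem Regular.separable (hI : I.Regular Ω) {t : ℕ} {h : Fin t → H} {d : Fin t → ℝ}
    (hs : GammaSeparates (I.φ '' Ω) I.y I.γ h d) : I.Separable Ω t := by
  have hγ := hI.γ_pos
  have hsep := fun i => exists_separator hγ hI.γ_le (h i) (d i)
    (P := I.φ '' {ω | ω ∈ Ω ∧ I.y (I.φ ω) = 1})
    (N := I.φ '' {ω | ω ∈ Ω ∧ inner ℝ (I.φ ω) (h i) + d i < -(I.γ * ‖h i‖)})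
    (by
      rintro _ ⟨ω, ⟨hω, hy⟩, rfl⟩
      have := (hs.1 _ (Set.mem_image_of_mem _ hω)).1 hy
      exact ⟨hI.norm_le ω hω, Set.mem_iInter.1 this i⟩)
    (by
      rintro _ ⟨ω, ⟨hω, hy⟩, rfl⟩
      exact ⟨hI.norm_le ω hω, hy⟩)
  choose z z1 z2 z3 using hsep
  -- The margin survives discretization since 7/20 - 1/100 > 1/4.
  have close : ∀ i, ∀ ω ∈ Ω,
      7 / 20 * I.γ ≤ I.y (I.φ ω) * (inner ℝ (I.φ ω) (z i).fst + (z i).snd) →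
      I.γ / 4 < inner ℝ (z i) (I.vec ω) := by
    intro i ω hω h1
    have h2 := (abs_le.1 (hI.abs_inner_vec_sub_le hω (z i))).1
    have h3 := z1 i
    nlinarith
  refine ⟨z, z1, fun ω hω hy i => close i ω hω ?_, fun ω hω hy => ?_⟩
  · rw [hy, one_mul]
    exact z2 i _ ⟨ω, ⟨hω, hy⟩, rfl⟩
  · obtain ⟨i, hi⟩ := hs.exists_cut hγ (Set.mem_image_of_mem _ hω) hy
    refine ⟨i, close i ω hω ?_⟩
    have := z3 i _ ⟨ω, ⟨hω, hi⟩, rfl⟩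
    rw [hy]
    linarith

/-- Any growing family of levels, in which every set of `t` nodes can be extended by a common
misclassified negative point, stops after `O(t / γ²)` steps. -/
theorem Regular.exists_stop (hI : I.Regular Ω) (hX : (X : Set _) ⊆ Ω) {t : ℕ}
    (hsep : I.Separable Ω t) (L : ℕ → Finset (Node s H)) (halted : ℕ → Prop)
    (hroot : (I.pos X, none) ∈ L 0) (hmono : ∀ k, L k ⊆ L (k + 1))
    (hinv : ∀ k, ∀ n ∈ L k, I.NodeInv X n)
    (hstep : ∀ k, ¬ halted k → ∀ f : Fin t → Node s H, (∀ i, f i ∈ L k) →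
      ∃ ω ∈ I.neg X, (∀ i, I.φ ω ∈ (f i).2.region) ∧ ∀ i, I.child (f i) ω ⊆ L (k + 1)) :
    ∃ k : ℕ, (k : ℝ) ≤ 256 * t / I.γ ^ 2 ∧ halted k := by
  obtain ⟨z, z1, zpos, zneg⟩ := hsep
  -- Invariant: `z i` has margin above γ/4 on the points and the state of `f i`, so extending this
  -- node by another such point cannot fail. One of the t nodes advances in each step.
  have claim : ∀ k, (∀ j < k, ¬ halted j) → ∃ f : Fin t → Node s H, (∀ i, f i ∈ L k) ∧
      (∀ i, ∀ ω ∈ (f i).1, I.γ / 4 < inner ℝ (z i) (I.vec ω)) ∧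
      (∀ i, ∀ u ∈ (f i).2, I.γ / 4 < inner ℝ (z i) u) ∧
      (k : ℝ) ≤ ∑ i, energy (f i).2 := by
    intro k
    induction k with
    | zero =>
      intro _
      refine ⟨fun _ => (I.pos X, none), fun _ => hroot, fun i ω hω => ?_, by simp, by simp [energy]⟩
      obtain ⟨h1, h2⟩ := mem_pos.1 hω
      exact zpos ω (hX h1) h2 i
    | succ k ih =>
      intro hk
      obtain ⟨f, f1, f2, f3, f4⟩ := ih fun j hj => hk j (by omega)
      obtain ⟨ω, hω, hr, hc⟩ := hstep k (hk k (by omega)) f f1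
      obtain ⟨hωX, hy⟩ := mem_neg.1 hω
      obtain ⟨i, hi⟩ := zneg ω (hX hωX) hy
      have hn := hinv k _ (f1 i)
      have hA : ∀ ω' ∈ insert ω (f i).1, I.γ / 4 < inner ℝ (z i) (I.vec ω') := by
        intro ω' h'
        rcases Finset.mem_insert.1 h' with rfl | h'
        · exact hi
        · exact f2 i ω' h'
      obtain ⟨u, hu, hzu⟩ := hI.exists_lpOut hX (Finset.insert_subset hωX hn.subset)
        (Finset.insert_nonempty _ _) (z1 i) hA hn.derived (f3 i)
      set n' : Node s H := (insert ω (f i).1, some u) with hn'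
      have hchild : n' ∈ I.child (f i) ω := mem_child.2 ⟨u, hu, rfl⟩
      have he := hI.energy_child hX hn hω (hr i) hchild
      refine ⟨Function.update f i n', fun j => ?_, fun j => ?_, fun j => ?_, ?_⟩
      · rcases eq_or_ne j i with rfl | hj
        · rw [Function.update_self]
          exact hc _ hchild
        · rw [Function.update_of_ne hj]
          exact hmono k (f1 j)
      · rcases eq_or_ne j i with rfl | hj
        · rw [Function.update_self]
          exact hA
        · rw [Function.update_of_ne hj]
          exact f2 j
      · rcases eq_or_ne j i with rfl | hj
        · rw [Function.update_self]
          rintro u' ⟨⟩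
          exact hzu
        · rw [Function.update_of_ne hj]
          exact f3 j
      · have e1 : ∑ j, energy (f j).2 + 1 ≤ ∑ j, energy (Function.update f i n' j).2 := by
          rw [← Finset.add_sum_erase _ _ (Finset.mem_univ i),
            ← Finset.add_sum_erase _ (fun j => energy (Function.update f i n' j).2)
              (Finset.mem_univ i)]
          have e2 : ∑ j ∈ Finset.univ.erase i, energy (Function.update f i n' j).2 =
              ∑ j ∈ Finset.univ.erase i, energy (f j).2 := by
            refine Finset.sum_congr rfl fun j hj => ?_
            rw [Function.update_of_ne (Finset.ne_of_mem_erase hj)]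
          rw [e2, Function.update_self]
          linarith
        push_cast
        linarith
  by_contra hcon
  push Not at hcon
  have hγ := hI.γ_pos
  have h0 : (0 : ℝ) ≤ 256 * t / I.γ ^ 2 := by positivity
  obtain ⟨f, f1, -, -, f4⟩ := claim (⌊256 * t / I.γ ^ 2⌋₊ + 1) fun j hj => by
    refine hcon j ((Nat.cast_le.2 (Nat.lt_succ_iff.1 hj)).trans (Nat.floor_le h0))
  have h1 : ∑ i, energy (f i).2 ≤ ∑ _i : Fin t, 256 / I.γ ^ 2 :=
    Finset.sum_le_sum fun i _ => energy_le hγ (hinv _ _ (f1 i)).derived.1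
  have h2 := Nat.lt_floor_add_one (256 * t / I.γ ^ 2)
  have h3 : ∑ _i : Fin t, 256 / I.γ ^ 2 = 256 * t / I.γ ^ 2 := by
    simp; ring
  push_cast at f4
  linarith

/-! ### The separation algorithm -/

theorem mem_properCalls {N : Finset (Node s H)} {p : Node s H × Euc s} :
    p ∈ I.properCalls X N ↔ p.1 ∈ N ∧ p.2 ∈ I.neg X ∧ I.φ p.2 ∈ p.1.2.region := by
  simp [properCalls, and_assoc]

theorem Regular.nodeInv_properLevel (hI : I.Regular Ω) (hX : (X : Set _) ⊆ Ω) (k : ℕ) :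
    ∀ n ∈ I.properLevel X k, I.NodeInv X n := by
  classical
  induction k with
  | zero =>
    intro n hn
    rw [properLevel, Finset.mem_singleton] at hn
    exact hn ▸ I.nodeInv_root X
  | succ k ih =>
    intro n hn
    rw [properLevel, Finset.mem_union, Finset.mem_biUnion] at hn
    rcases hn with hn | ⟨p, hp, hn⟩
    · exact ih n hn
    · obtain ⟨p1, p2, -⟩ := mem_properCalls.1 hp
      exact hI.nodeInv_child hX (ih _ p1) (mem_neg.1 p2).1 hn

theorem mem_properFound {t k : ℕ} {G : Finset (Node s H)} :
    G ∈ I.properFound t X k ↔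
      G ⊆ I.properLevel X k ∧ G.card ≤ t ∧ I.ConsistentOn X (poly G) := by
  simp [properFound]

theorem Regular.exists_properFound (hI : I.Regular Ω) (hX : (X : Set _) ⊆ Ω) {t : ℕ}
    (hsep : I.Separable Ω t) :
    ∃ k : ℕ, (k : ℝ) ≤ 256 * t / I.γ ^ 2 ∧ (I.properFound t X k).Nonempty := by
  classical
  refine hI.exists_stop hX hsep (I.properLevel X) (fun k => (I.properFound t X k).Nonempty)
    ?_ (fun k => ?_) (hI.nodeInv_properLevel hX) ?_
  · simp [properLevel]
  · intro n hn
    rw [properLevel]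
    exact Finset.mem_union_left _ hn
  · intro k hk f hf
    -- The t followed nodes, possibly coinciding, are among the candidates already rejected at this
    -- level.
    have h1 : Finset.univ.image f ∉ I.properFound t X k := fun h => hk ⟨_, h⟩
    have hsub : Finset.univ.image f ⊆ I.properLevel X k := by
      intro n hn
      obtain ⟨i, -, rfl⟩ := Finset.mem_image.1 hn
      exact hf i
    rw [mem_properFound] at h1
    have hcard : (Finset.univ.image f).card ≤ t := Finset.card_image_le.trans (by simp)
    have h2 : ¬ I.ConsistentOn X (poly (Finset.univ.image f)) := fun h => h1 ⟨hsub, hcard, h⟩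
    rw [ConsistentOn] at h2
    push Not at h2
    obtain ⟨ω, hω, hmis⟩ := h2
    obtain ⟨m1, m2⟩ := exists_neg_of_misclassified
      (fun n hn => hI.nodeInv_properLevel hX k n (hsub hn)) hω hmis
    have m3 : ∀ i, I.φ ω ∈ (f i).2.region := fun i =>
      m2 _ (Finset.mem_image_of_mem _ (Finset.mem_univ i))
    refine ⟨ω, m1, m3, fun i n hn => ?_⟩
    rw [properLevel]
    refine Finset.mem_union_right _ (Finset.mem_biUnion.2 ⟨(f i, ω), ?_, hn⟩)
    exact mem_properCalls.2 ⟨hf i, m1, m3 i⟩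

theorem Regular.properHaltsWithin (hI : I.Regular Ω) (hX : (X : Set _) ⊆ Ω) {t : ℕ}
    (hsep : I.Separable Ω t) {M N : ℝ} (hM : 256 * t / I.γ ^ 2 ≤ M)
    (hN : 256 / I.γ ^ 2 + 1 ≤ N) : I.ProperHaltsWithin M N t X := by
  obtain ⟨k, hk, hf⟩ := hI.exists_properFound hX hsep
  refine ⟨k, hk.trans hM, hf, fun j _ p hp => ?_⟩
  obtain ⟨p1, p2, -⟩ := mem_properCalls.1 hp
  have hn := hI.nodeInv_properLevel hX j _ p1
  exact hI.lpHaltsWithin hX (Finset.insert_subset (mem_neg.1 p2).1 hn.subset)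
    (Finset.insert_nonempty _ _) hn.derived hN

theorem Regular.exists_properReturns (hI : I.Regular Ω) (hX : (X : Set _) ⊆ Ω) {t : ℕ}
    (hsep : I.Separable Ω t) : ∃ F, I.ProperReturns t X F := by
  classical
  obtain ⟨k, -, hf⟩ := hI.exists_properFound hX hsep
  have hex : ∃ k, (I.properFound t X k).Nonempty := ⟨k, hf⟩
  obtain ⟨G, hG⟩ := Nat.find_spec hex
  exact ⟨_, Nat.find hex, fun j hj => Finset.not_nonempty_iff_eq_empty.1 (Nat.find_min hex hj),
    G, hG, rfl⟩

theorem isPolyhedron_poly (G : Finset (Node s H)) : IsPolyhedron G.card (poly G) := by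
  have hreg : ∀ S : State H, ∃ h d, S.region = halfspace h d := by
    intro S
    cases S with
    | none => exact ⟨0, 0, by simp [State.region, halfspace]⟩
    | some u => exact ⟨u.fst, u.snd, rfl⟩
  choose h d hhd using hreg
  let e := G.equivFin.symm
  refine ⟨fun i => h (e i).1.2, fun i => d (e i).1.2, ?_⟩
  ext z
  simp only [mem_poly, Set.mem_iInter, ← hhd]
  exact ⟨fun hz i => hz _ (e i).2, fun hz n hn => by simpa using hz (e.symm ⟨n, hn⟩)⟩

theorem Regular.properReturns_spec (hI : I.Regular Ω) (hX : (X : Set _) ⊆ Ω) {t : ℕ} {F : Set H}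
    (hF : I.ProperReturns t X F) : I.ConsistentOn X F ∧
      ∃ G : Finset (Node s H), F = poly G ∧ G.card ≤ t ∧ ∀ n ∈ G, I.Derived X n.2 := by
  obtain ⟨k, -, G, hG, rfl⟩ := hF
  obtain ⟨h1, h2, h3⟩ := mem_properFound.1 hG
  exact ⟨h3, G, rfl, h2, fun n hn => (hI.nodeInv_properLevel hX k n (h1 hn)).derived⟩

/-! ### The improper-separation algorithm -/

theorem mem_misclassified {N : Finset (Node s H)} {ω : Euc s} :
    ω ∈ I.misclassified X N ↔ ω ∈ X ∧ ¬ CorrectlyClassifies I.y (poly N) (I.φ ω) := by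
  simp [misclassified]

theorem pick_misclassified {N : Finset (Node s H)} (h : I.misclassified X N ≠ ∅) :
    I.pick (I.misclassified X N) ∈ I.misclassified X N :=
  I.pick_mem _ (Finset.nonempty_iff_ne_empty.2 h)

theorem Regular.nodeInv_improperLevel (hI : I.Regular Ω) (hX : (X : Set _) ⊆ Ω) (k : ℕ) :
    ∀ n ∈ I.improperLevel X k, I.NodeInv X n := by
  classical
  induction k with
  | zero =>
    intro n hn
    rw [improperLevel, Finset.mem_singleton] at hn
    exact hn ▸ I.nodeInv_root X
  | succ k ih =>
    intro n hn
    rw [improperLevel] at hn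
    split_ifs at hn with h
    · exact ih n hn
    · rw [Finset.mem_union, Finset.mem_biUnion] at hn
      rcases hn with hn | ⟨p, hp, hn⟩
      · exact ih n hn
      · exact hI.nodeInv_child hX (ih _ hp) (mem_misclassified.1 (pick_misclassified h)).1 hn

theorem Regular.exists_misclassified_eq_empty (hI : I.Regular Ω) (hX : (X : Set _) ⊆ Ω) {t : ℕ}
    (hsep : I.Separable Ω t) :
    ∃ k : ℕ, (k : ℝ) ≤ 256 * t / I.γ ^ 2 ∧ I.misclassified X (I.improperLevel X k) = ∅ := by
  classical
  refine hI.exists_stop hX hsep (I.improperLevel X)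
    (fun k => I.misclassified X (I.improperLevel X k) = ∅) ?_ (fun k => ?_)
    (hI.nodeInv_improperLevel hX) ?_
  · simp [improperLevel]
  · rw [improperLevel]
    split_ifs
    · exact subset_rfl
    · exact fun n hn => Finset.mem_union_left _ hn
  · intro k hk f hf
    obtain ⟨h1, h2⟩ := mem_misclassified.1 (pick_misclassified hk)
    obtain ⟨m1, m2⟩ := exists_neg_of_misclassified (hI.nodeInv_improperLevel hX k) h1 h2
    refine ⟨_, m1, fun i => m2 _ (hf i), fun i n hn => ?_⟩
    rw [improperLevel, if_neg hk]
    exact Finset.mem_union_right _ (Finset.mem_biUnion.2 ⟨f i, hf i, hn⟩)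

theorem Regular.improperHaltsWithin (hI : I.Regular Ω) (hX : (X : Set _) ⊆ Ω) {t : ℕ}
    (hsep : I.Separable Ω t) {M N : ℝ} (hM : 256 * t / I.γ ^ 2 ≤ M)
    (hN : 256 / I.γ ^ 2 + 1 ≤ N) : I.ImproperHaltsWithin M N X := by
  obtain ⟨k, hk, hf⟩ := hI.exists_misclassified_eq_empty hX hsep
  refine ⟨k, hk.trans hM, hf, fun j _ hj n hn => ?_⟩
  have hinv := hI.nodeInv_improperLevel hX j _ hn
  exact hI.lpHaltsWithin hX (Finset.insert_subset
    (mem_misclassified.1 (pick_misclassified hj)).1 hinv.subset)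
    (Finset.insert_nonempty _ _) hinv.derived hN

theorem Regular.exists_improperReturns (hI : I.Regular Ω) (hX : (X : Set _) ⊆ Ω) {t : ℕ}
    (hsep : I.Separable Ω t) : ∃ F, I.ImproperReturns X F := by
  classical
  obtain ⟨k, -, hf⟩ := hI.exists_misclassified_eq_empty hX hsep
  have hex : ∃ k, I.misclassified X (I.improperLevel X k) = ∅ := ⟨k, hf⟩
  exact ⟨_, Nat.find hex, fun j hj => Nat.find_min hex hj, Nat.find_spec hex, rfl⟩

/-- Each node gets at most one child per step, with energy larger by at least 1, so a step
multiplies the weighted count by at most 1 + r. -/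
theorem Regular.sum_improperLevel_le (hI : I.Regular Ω) (hX : (X : Set _) ⊆ Ω) {r : ℝ}
    (hr : 0 < r) (hr1 : r ≤ 1) (k : ℕ) :
    ∑ n ∈ I.improperLevel X k, r ^ energy n.2 ≤ (1 + r) ^ k := by
  classical
  induction k with
  | zero => simp [improperLevel, energy]
  | succ k ih =>
    have h0 : 0 ≤ (1 + r) ^ k * r := by positivity
    rw [improperLevel]
    split_ifs with h
    · rw [pow_succ]
      linarith
    obtain ⟨h1, h2⟩ := mem_misclassified.1 (pick_misclassified h)
    obtain ⟨m1, m2⟩ := exists_neg_of_misclassified (hI.nodeInv_improperLevel hX k) h1 h2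
    set ω := I.pick (I.misclassified X (I.improperLevel X k))
    set L := I.improperLevel X k
    have hnn : ∀ n : Node s H, 0 ≤ r ^ energy n.2 := fun n => by positivity
    have hunion : ∑ n ∈ L ∪ L.biUnion fun n => I.child n ω, r ^ energy n.2 ≤
        ∑ n ∈ L, r ^ energy n.2 + ∑ n ∈ L.biUnion fun n => I.child n ω, r ^ energy n.2 := by
      rw [← Finset.sum_union_inter]
      exact le_add_of_nonneg_right (Finset.sum_nonneg fun n _ => hnn n)
    have hbi : ∀ L' : Finset (Node s H), ∑ n ∈ L'.biUnion fun n => I.child n ω, r ^ energy n.2 ≤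
        ∑ n ∈ L', ∑ n' ∈ I.child n ω, r ^ energy n'.2 := by
      intro L'
      induction L' using Finset.induction_on with
      | empty => simp
      | insert a L' ha ih' =>
        rw [Finset.biUnion_insert, Finset.sum_insert ha]
        refine le_trans ?_ (add_le_add_right ih' _)
        rw [← Finset.sum_union_inter]
        exact le_add_of_nonneg_right (Finset.sum_nonneg fun n _ => hnn n)
    have hchild : ∀ n ∈ L, ∑ n' ∈ I.child n ω, r ^ energy n'.2 ≤ r * r ^ energy n.2 := by
      intro n hn
      calc ∑ n' ∈ I.child n ω, r ^ energy n'.2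
          ≤ (I.child n ω).card • (r * r ^ energy n.2) := by
            refine Finset.sum_le_card_nsmul _ _ _ fun n' hn' => ?_
            have := hI.energy_child hX (hI.nodeInv_improperLevel hX k n hn) m1 (m2 n hn) hn'
            rw [mul_comm, ← Real.rpow_add_one hr.ne']
            exact Real.rpow_le_rpow_of_exponent_ge hr hr1 this
        _ ≤ 1 • (r * r ^ energy n.2) := by
            refine nsmul_le_nsmul_left (by positivity) (card_child_le n ω)
        _ = r * r ^ energy n.2 := one_nsmul _
    calc _ ≤ _ := hunion
      _ ≤ ∑ n ∈ L, r ^ energy n.2 + ∑ n ∈ L, r * r ^ energy n.2 :=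
        add_le_add_right ((hbi L).trans (Finset.sum_le_sum hchild)) _
      _ = (∑ n ∈ L, r ^ energy n.2) * (1 + r) := by rw [← Finset.mul_sum]; ring
      _ ≤ (1 + r) ^ (k + 1) := by
        rw [pow_succ]
        gcongr

theorem Regular.card_improperLevel_le (hI : I.Regular Ω) (hX : (X : Set _) ⊆ Ω) {t : ℕ}
    {k : ℕ} (hk : (k : ℝ) ≤ 256 * t / I.γ ^ 2) :
    ((I.improperLevel X k).card : ℝ) ≤ ((t : ℝ) + 1) ^ (768 / I.γ ^ 2) ∨ t = 0 := by
  rcases Nat.eq_zero_or_pos t with h0 | ht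
  · exact Or.inr h0
  left
  have hγ := hI.γ_pos
  have ht1 : (1 : ℝ) ≤ t := by exact_mod_cast ht
  have hT : (0 : ℝ) < (t : ℝ) + 1 := by linarith
  -- With this weight every node counts at least (t+1)^(-256/γ²), while (1+r)^k ≤ exp(kr) ≤
  -- exp(256/γ²).
  set r : ℝ := ((t : ℝ) + 1)⁻¹ with hr
  have hr0 : 0 < r := by positivity
  have hr1 : r ≤ 1 := inv_le_one_of_one_le₀ (by linarith)
  have h1 := hI.sum_improperLevel_le hX hr0 hr1 k
  have h2 : ((I.improperLevel X k).card : ℝ) * r ^ (256 / I.γ ^ 2) ≤ (1 + r) ^ k := by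
    refine le_trans ?_ h1
    rw [← nsmul_eq_mul]
    refine Finset.card_nsmul_le_sum _ _ _ fun n hn => ?_
    exact Real.rpow_le_rpow_of_exponent_ge hr0 hr1
      (energy_le hγ (hI.nodeInv_improperLevel hX k n hn).derived.1)
  have h3 : (1 + r) ^ k ≤ ((t : ℝ) + 1) ^ (512 / I.γ ^ 2) := by
    calc (1 + r) ^ k ≤ (Real.exp r) ^ k := by
          gcongr
          rw [add_comm]
          exact Real.add_one_le_exp r
      _ = Real.exp (k * r) := by rw [← Real.exp_nat_mul]
      _ ≤ Real.exp (Real.log (t + 1) * (512 / I.γ ^ 2)) := by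
          rw [Real.exp_le_exp]
          have e1 : (k : ℝ) * r ≤ 256 / I.γ ^ 2 := by
            rw [hr, ← div_eq_mul_inv, div_le_iff₀ hT]
            refine hk.trans ?_
            have : (0 : ℝ) ≤ 256 / I.γ ^ 2 := by positivity
            calc 256 * (t : ℝ) / I.γ ^ 2 = 256 / I.γ ^ 2 * t := by ring
              _ ≤ 256 / I.γ ^ 2 * (t + 1) := by gcongr; linarith
          -- Base e is traded for base t + 1 by doubling the exponent.
          have e2 : 1 / 2 ≤ Real.log (t + 1) := by
            have := Real.log_le_log two_pos (show (2 : ℝ) ≤ t + 1 by linarith)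
            linarith [Real.log_two_gt_d9]
          calc (k : ℝ) * r ≤ 256 / I.γ ^ 2 := e1
            _ = 1 / 2 * (512 / I.γ ^ 2) := by ring
            _ ≤ Real.log (t + 1) * (512 / I.γ ^ 2) := by gcongr
      _ = ((t : ℝ) + 1) ^ (512 / I.γ ^ 2) := by rw [Real.rpow_def_of_pos hT]
  rw [hr, Real.inv_rpow hT.le, ← div_eq_mul_inv, div_le_iff₀ (by positivity)] at h2
  calc ((I.improperLevel X k).card : ℝ) ≤ _ := h2
    _ ≤ ((t : ℝ) + 1) ^ (512 / I.γ ^ 2) * ((t : ℝ) + 1) ^ (256 / I.γ ^ 2) := by gcongr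
    _ = ((t : ℝ) + 1) ^ (768 / I.γ ^ 2) := by
      rw [← Real.rpow_add hT]
      congr 1
      ring

theorem Regular.improperReturns_spec (hI : I.Regular Ω) (hX : (X : Set _) ⊆ Ω) {t : ℕ}
    (ht : 1 ≤ t) (hsep : I.Separable Ω t) {F : Set H} (hF : I.ImproperReturns X F) :
    I.ConsistentOn X F ∧ ∃ G : Finset (Node s H), F = poly G ∧
      (G.card : ℝ) ≤ ((t : ℝ) + 1) ^ (768 / I.γ ^ 2) ∧ ∀ n ∈ G, I.Derived X n.2 := by
  obtain ⟨k, hmin, hk, rfl⟩ := hF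
  obtain ⟨k', hk', hk''⟩ := hI.exists_misclassified_eq_empty hX hsep
  have hle : k ≤ k' := by
    by_contra hlt
    exact hmin k' (not_le.1 hlt) hk''
  refine ⟨fun ω hω => ?_, _, rfl, ?_, fun n hn => (hI.nodeInv_improperLevel hX k n hn).derived⟩
  · by_contra hcon
    have := mem_misclassified.2 ⟨hω, hcon⟩
    rw [hk] at this
    simp at this
  · refine (hI.card_improperLevel_le hX (k := k) ?_).resolve_right (by omega)
    exact (Nat.cast_le.2 hle).trans hk'

end Impl

end RKHSPoly

namespace RKHSPoly

variable {s : ℕ} {H : Type*} [NormedAddCommGroup H] [InnerProductSpace ℝ H]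

/-! ### A union bound for sample compression -/

/-- Once the draws indexed by `J` are fixed, so is the set `B`, and the other m - |J| independent
draws must all miss a set of measure above ε. -/
theorem measure_pi_consistent_le {α : Type*} [MeasurableSpace α] (P : Measure α)
    [IsProbabilityMeasure P] {m : ℕ} (J : Finset (Fin m)) {B : (Fin m → α) → Set α}
    (hB : MeasurableSet {p : (Fin m → α) × α | p.2 ∈ B p.1})
    (hdep : ∀ w w', (∀ j ∈ J, w j = w' j) → B w = B w') {ε : ℝ} (hε : ε ≤ 1) :
    Measure.pi (fun _ : Fin m => P) {w | ENNReal.ofReal ε < P (B w) ∧ ∀ j, w j ∉ B w} ≤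
      ENNReal.ofReal ((1 - ε) ^ (m - J.card)) := by
  classical
  set E : Set (Fin m → α) := {w | ENNReal.ofReal ε < P (B w) ∧ ∀ j, w j ∉ B w} with hE
  have hEm : MeasurableSet E := by
    have h1 : MeasurableSet {w : Fin m → α | ENNReal.ofReal ε < P (B w)} :=
      measurableSet_lt measurable_const (measurable_measure_prodMk_left hB)
    have h2 : ∀ j, MeasurableSet {w : Fin m → α | w j ∉ B w} := fun j =>
      (((measurable_id.prodMk (measurable_pi_apply j)) :
        Measurable fun w : Fin m → α => (w, w j)) hB).compl
    have h3 : E = {w : Fin m → α | ENNReal.ofReal ε < P (B w)} ∩ ⋂ j, {w | w j ∉ B w} := by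
      ext w; simp [hE]
    rw [h3]
    exact h1.inter (MeasurableSet.iInter h2)
  set e := MeasurableEquiv.piEquivPiSubtypeProd (fun _ : Fin m => α) (fun j => j ∈ J) with he
  have hmp := measurePreserving_piEquivPiSubtypeProd (fun _ : Fin m => P) (fun j => j ∈ J)
  have hmps := hmp.symm
  rw [← hmps.measure_preimage hEm.nullMeasurableSet, Measure.prod_apply (hmps.measurable hEm)]
  have hval : ∀ (a : {j // j ∈ J} → α) (b : {j // j ∉ J} → α) (j : Fin m),
      e.symm (a, b) j = if h : j ∈ J then a ⟨j, h⟩ else b ⟨j, h⟩ := fun a b j => rfl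
  have hsec : ∀ a : {j // j ∈ J} → α, Measure.pi (fun _ : {j // j ∉ J} => P)
      (Prod.mk a ⁻¹' (e.symm ⁻¹' E)) ≤ ENNReal.ofReal ((1 - ε) ^ (m - J.card)) := by
    intro a
    rcases (Prod.mk a ⁻¹' (e.symm ⁻¹' E)).eq_empty_or_nonempty with h0 | ⟨b₀, hb₀⟩
    · rw [h0]; simp
    set B₀ := B (e.symm (a, b₀)) with hB₀
    have hsame : ∀ b, B (e.symm (a, b)) = B₀ := fun b => hdep _ _ fun j hj => by
      simp [hval, hj]
    have hB₀m : MeasurableSet B₀ := measurable_prodMk_left hB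
    have hlt : ENNReal.ofReal ε < P B₀ := hb₀.1
    have hcompl : P B₀ᶜ ≤ ENNReal.ofReal (1 - ε) := by
      rw [prob_compl_eq_one_sub hB₀m]
      calc 1 - P B₀ ≤ 1 - ENNReal.ofReal ε := tsub_le_tsub_left hlt.le _
        _ ≤ ENNReal.ofReal (1 - ε) := by
          rw [tsub_le_iff_right]
          calc (1 : ENNReal) = ENNReal.ofReal (1 - ε + ε) := by simp
            _ ≤ _ := ENNReal.ofReal_add_le
    have hsub : Prod.mk a ⁻¹' (e.symm ⁻¹' E) ⊆ Set.pi Set.univ fun _ : {j // j ∉ J} => B₀ᶜ := by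
      intro b hb j _
      have := (hb : e.symm (a, b) ∈ E).2 j.1
      rw [hsame, hval, dif_neg j.2] at this
      exact this
    refine (measure_mono hsub).trans ?_
    rw [Measure.pi_pi, Finset.prod_const, Finset.card_univ]
    have hcard : Fintype.card {j // j ∉ J} = m - J.card := by
      rw [Fintype.card_subtype_compl]
      simp
    rw [hcard, ENNReal.ofReal_pow (by linarith)]
    gcongr
  refine (lintegral_mono hsec).trans ?_
  rw [lintegral_const, measure_univ, mul_one]

theorem measure_pi_exists_consistent_le {α ι : Type*} [MeasurableSpace α] [Fintype ι]
    (P : Measure α) [IsProbabilityMeasure P] {m k : ℕ} (J : ι → Finset (Fin m))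
    (hJ : ∀ σ, (J σ).card ≤ k) {B : ι → (Fin m → α) → Set α}
    (hB : ∀ σ, MeasurableSet {p : (Fin m → α) × α | p.2 ∈ B σ p.1})
    (hdep : ∀ σ w w', (∀ j ∈ J σ, w j = w' j) → B σ w = B σ w') {ε : ℝ} (hε0 : 0 ≤ ε)
    (hε : ε ≤ 1) :
    Measure.pi (fun _ : Fin m => P)
        {w | ∃ σ, ENNReal.ofReal ε < P (B σ w) ∧ ∀ j, w j ∉ B σ w} ≤
      ENNReal.ofReal (Fintype.card ι * (1 - ε) ^ (m - k)) := by
  have hset : {w | ∃ σ, ENNReal.ofReal ε < P (B σ w) ∧ ∀ j, w j ∉ B σ w} =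
      ⋃ σ, {w : Fin m → α | ENNReal.ofReal ε < P (B σ w) ∧ ∀ j, w j ∉ B σ w} := by
    ext w; simp
  rw [hset]
  calc _ ≤ ∑ σ, Measure.pi (fun _ : Fin m => P)
          {w | ENNReal.ofReal ε < P (B σ w) ∧ ∀ j, w j ∉ B σ w} := measure_iUnion_fintype_le _ _
    _ ≤ ∑ _σ : ι, ENNReal.ofReal ((1 - ε) ^ (m - k)) := by
      refine Finset.sum_le_sum fun σ _ => ?_
      refine (measure_pi_consistent_le P (J σ) (hB σ) (hdep σ) hε).trans ?_
      refine ENNReal.ofReal_le_ofReal (pow_le_pow_of_le_one (by linarith) (by linarith) ?_)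
      exact Nat.sub_le_sub_left (hJ σ) m
    _ = _ := by
      rw [Finset.sum_const, nsmul_eq_mul, Finset.card_univ,
        ENNReal.ofReal_mul (by positivity), ENNReal.ofReal_natCast]

/-! ### Measurability of the computed states -/

/-- The state reached by processing a list of constraint vectors. -/
noncomputable def decode (β : ℝ) (l : List (Aff H)) : State H := l.foldl (advance β) none

theorem measurable_latticePoint (β : ℝ) : Measurable (latticePoint β : Euc s → Euc s) := by
  unfold latticePoint
  refine (WithLp.measurable_toLp 2 _).comp (measurable_pi_lambda _ fun i => ?_)
  have h1 : Measurable fun ω : Euc s => round (ω i / β) := by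
    simp only [round_eq]
    have h0 : Measurable fun ω : Euc s => ω i :=
      (EuclideanSpace.proj (𝕜 := ℝ) i).continuous.measurable
    exact ((h0.div_const β).add_const _).floor
  exact (measurable_from_top.comp h1).const_mul β

/-- Strong measurability is the right notion here: `H` carries no σ-algebra and is not assumed
separable. -/
theorem stronglyMeasurable_projBall {W : Type*} [MeasurableSpace W] {f : W → H}
    (hf : StronglyMeasurable f) : StronglyMeasurable fun w => projBall (f w) := by
  unfold projBall
  exact ((measurable_const.max hf.norm.measurable).inv.stronglyMeasurable).smul hf

theorem stronglyMeasurable_combine {W : Type*} [MeasurableSpace W] (β : ℝ) {u v : W → Aff H}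
    (hu : StronglyMeasurable u) (hv : StronglyMeasurable v) :
    StronglyMeasurable fun w =>
      Impl.combine (β * (⌊Impl.projCoeff (u w) (v w) / β⌋ : ℝ)) (u w) (v w) := by
  have h1 : Measurable fun w => Impl.projCoeff (u w) (v w) :=
    (hv.inner (hv.sub hu)).measurable.div ((hv.sub hu).norm.measurable.pow_const 2)
  have h2 : Measurable fun w => (⌊Impl.projCoeff (u w) (v w) / β⌋ : ℝ) :=
    measurable_from_top.comp (h1.div_const β).floor
  have h3 := (h2.const_mul β).stronglyMeasurable
  exact (h3.smul hu).add ((stronglyMeasurable_const.sub h3).smul hv)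

/-- After the first update the state stays nonempty, so the fold is tracked by a vector-valued
function. -/
theorem exists_stronglyMeasurable_foldl {W : Type*} [MeasurableSpace W] (β : ℝ)
    (l : List (W → Aff H)) :
    ∀ {u : W → Aff H}, (∀ v ∈ l, StronglyMeasurable v) → StronglyMeasurable u →
      ∃ u' : W → Aff H, StronglyMeasurable u' ∧
        ∀ w, (l.map fun v => v w).foldl (advance β) (some (u w)) = some (u' w) := by
  induction l with
  | nil => exact fun {u} _ hu => ⟨u, hu, fun w => rfl⟩
  | cons v l ih =>
    intro u hl hu
    exact ih (fun v' hv' => hl v' (List.mem_cons_of_mem _ hv'))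
      (stronglyMeasurable_combine β hu (hl v List.mem_cons_self))

theorem measurableSet_decode {W : Type*} [MeasurableSpace W] (β : ℝ) {φ : Euc s → H}
    (hφ : Continuous φ) {l : List (W → Aff H)} (hl : ∀ v ∈ l, StronglyMeasurable v) :
    MeasurableSet {p : W × Euc s | φ p.2 ∈ (decode β (l.map fun v => v p.1)).region} := by
  cases l with
  | nil => simp [decode, State.region]
  | cons v l =>
    obtain ⟨u, hu, hu'⟩ := exists_stronglyMeasurable_foldl β l
      (fun v' hv' => hl v' (List.mem_cons_of_mem _ hv')) (hl v List.mem_cons_self)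
    have h1 : ∀ p : W × Euc s, φ p.2 ∈ (decode β ((v :: l).map fun v => v p.1)).region ↔
        0 ≤ inner ℝ (φ p.2) (u p.1).fst + (u p.1).snd := by
      intro p
      have : decode β ((v :: l).map fun v => v p.1) = some (u p.1) := hu' p.1
      rw [this]
      rfl
    simp only [h1]
    have hu2 : StronglyMeasurable fun p : W × Euc s => u p.1 :=
      hu.comp_measurable measurable_fst
    have hfst : StronglyMeasurable fun p : W × Euc s => (u p.1).fst :=
      (WithLp.prod_continuous_ofLp 2 H ℝ).fst.comp_stronglyMeasurable hu2
    have hsnd : StronglyMeasurable fun p : W × Euc s => (u p.1).snd :=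
      (WithLp.prod_continuous_ofLp 2 H ℝ).snd.comp_stronglyMeasurable hu2
    have hφ2 : StronglyMeasurable fun p : W × Euc s => φ p.2 :=
      hφ.comp_stronglyMeasurable measurable_snd.stronglyMeasurable
    exact measurableSet_le measurable_const ((hφ2.inner hfst).measurable.add hsnd.measurable)

/-! ### Encoding of polyhedra by tuples of short lists -/

/-- Padding with `none` makes the short lists a finite type that is easy to count. -/
theorem exists_reduceOption_ofFn {α : Type*} (l : List α) {q : ℕ} (h : l.length ≤ q) :
    ∃ f : Fin q → Option α, (List.ofFn f).reduceOption = l := by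
  induction l generalizing q with
  | nil =>
    refine ⟨fun _ => none, ?_⟩
    rw [List.ofFn_const]
    simp
  | cons a l ih =>
    obtain ⟨q, rfl⟩ : ∃ q', q = q' + 1 := ⟨q - 1, by simp at h; omega⟩
    obtain ⟨f, hf⟩ := ih (q := q) (by simpa using h)
    exact ⟨Fin.cons (some a) f, by simp [List.ofFn_succ, hf]⟩

/-- The list of constraint vectors encoded by `f`. -/
def listOf {A : Type*} {q : ℕ} (g : A → Aff H) (f : Fin q → Option A) : List (Aff H) :=
  (List.ofFn f).reduceOption.map g

/-- The polyhedron encoded by `σ`. -/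
noncomputable def polyOf {A : Type*} {T q : ℕ} (β : ℝ) (g : A → Aff H)
    (σ : Fin T → Fin q → Option A) : Set H :=
  ⋂ i, (decode β (listOf g (σ i))).region

/-- Unused indices receive `c₀`, which does not affect the intersection. -/
theorem exists_iInter_fin {α γ E : Type*} (G : Finset α) {T : ℕ} (hT : G.card ≤ T)
    (R : α → Set E) (Q : γ → Set E) {c₀ : γ} (hc₀ : Q c₀ = Set.univ)
    (h : ∀ n ∈ G, ∃ c, R n = Q c) : ∃ σ : Fin T → γ, ⋂ n ∈ G, R n = ⋂ i, Q (σ i) := by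
  have : Nonempty γ := ⟨c₀⟩
  choose! c hc using h
  let e := G.equivFin.symm
  refine ⟨fun i => if hi : i.1 < G.card then c (e ⟨i, hi⟩) else c₀, ?_⟩
  ext z
  simp only [Set.mem_iInter]
  constructor
  · intro hz i
    split_ifs with hi
    · rw [← hc _ (e ⟨i, hi⟩).2]
      exact hz _ (e ⟨i, hi⟩).2
    · rw [hc₀]; trivial
  · intro hz n hn
    have h1 := hz ⟨e.symm ⟨n, hn⟩, (e.symm ⟨n, hn⟩).2.trans_le hT⟩
    simp only [Fin.is_lt, dif_pos, Fin.eta, Equiv.apply_symm_apply] at h1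
    rwa [hc n hn]

theorem exists_poly_eq_polyOf {A : Type*} {β : ℝ} (g : A → Aff H) {T q : ℕ}
    {G : Finset (Impl.Node s H)} (hT : G.card ≤ T)
    (hG : ∀ n ∈ G, ∃ l : List A, l.length ≤ q ∧ n.2 = decode β (l.map g)) :
    ∃ σ : Fin T → Fin q → Option A, Impl.poly G = polyOf β g σ := by
  refine exists_iInter_fin G hT (fun n => n.2.region)
    (fun f : Fin q → Option A => (decode β (listOf g f)).region) (c₀ := fun _ => none) ?_ ?_
  · simp [listOf, List.ofFn_const, decode, State.region]
  · intro n hn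
    obtain ⟨l, h1, h2⟩ := hG n hn
    obtain ⟨f, hf⟩ := exists_reduceOption_ofFn l h1
    exact ⟨f, by rw [h2, listOf, hf]⟩

theorem measurableSet_polyOf {A W : Type*} [MeasurableSpace W] {β : ℝ} {φ : Euc s → H}
    (hφ : Continuous φ) {g : W → A → Aff H} (hg : ∀ a, StronglyMeasurable fun w => g w a)
    {T q : ℕ} (σ : Fin T → Fin q → Option A) :
    MeasurableSet {p : W × Euc s | φ p.2 ∈ polyOf β (g p.1) σ} := by
  have h : {p : W × Euc s | φ p.2 ∈ polyOf β (g p.1) σ} =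
      ⋂ i, {p : W × Euc s | φ p.2 ∈ (decode β (listOf (g p.1) (σ i))).region} := by
    ext p; simp [polyOf]
  rw [h]
  refine MeasurableSet.iInter fun i => ?_
  have h2 := measurableSet_decode (W := W) β hφ
    (l := (List.ofFn (σ i)).reduceOption.map fun a w => g w a) (by
      intro v hv
      obtain ⟨a, -, rfl⟩ := List.mem_map.1 hv
      exact hg a)
  simpa [listOf, Function.comp_def] using h2

end RKHSPoly

namespace RKHSPoly

variable {s : ℕ} {H : Type*} [NormedAddCommGroup H] [InnerProductSpace ℝ H]

/-! ### PAC guarantees from finite families of encodings -/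

theorem polyOf_congr {A : Type*} {T q : ℕ} {β : ℝ} {g g' : A → Aff H}
    {σ : Fin T → Fin q → Option A} (h : ∀ i j a, σ i j = some a → g a = g' a) :
    polyOf β g σ = polyOf β g' σ := by
  have : ∀ i, listOf g (σ i) = listOf g' (σ i) := by
    intro i
    refine List.map_congr_left fun a ha => ?_
    rw [List.reduceOption_mem_iff, List.mem_ofFn] at ha
    obtain ⟨j, hj⟩ := ha
    exact h i j a hj
  simp only [polyOf, this]

/-- The elements that occur in an encoding. -/
def support {A : Type*} [DecidableEq A] {T q : ℕ} (σ : Fin T → Fin q → Option A) : Finset A :=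
  (Finset.univ : Finset (Fin T × Fin q)).biUnion fun p => (σ p.1 p.2).toFinset

theorem card_support_le {A : Type*} [DecidableEq A] {T q : ℕ} (σ : Fin T → Fin q → Option A) :
    (support σ).card ≤ T * q := by
  refine (Finset.card_biUnion_le_card_mul _ _ 1 fun p _ => ?_).trans (by simp)
  cases σ p.1 p.2 <;> simp

theorem mem_support {A : Type*} [DecidableEq A] {T q : ℕ} {σ : Fin T → Fin q → Option A}
    {i : Fin T} {j : Fin q} {a : A} (h : σ i j = some a) : a ∈ support σ :=
  Finset.mem_biUnion.2 ⟨(i, j), Finset.mem_univ _, by simp [h]⟩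

namespace Impl

variable {I : Impl s H} {Ω : Set (Euc s)}

/-- The outputs on samples in `Ω` are consistent intersections of at most `T` regions of states
that are determined by few sample points. -/
def ReturnsDerived (I : Impl s H) (Ω : Set (Euc s))
    (returns : Finset (Euc s) → Set H → Prop) (T : ℕ) : Prop :=
  ∀ X : Finset (Euc s), (X : Set (Euc s)) ⊆ Ω → ∀ F, returns X F → I.ConsistentOn X F ∧
    ∃ G : Finset (Node s H), F = poly G ∧ G.card ≤ T ∧ ∀ n ∈ G, I.Derived X n.2

-- This trades the arbitrary labels for a closed set, which makes the error sets measurable.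
omit [InnerProductSpace ℝ H] in
theorem correctlyClassifies_iff (hI : I.Regular Ω) {D : Set H}
    (hD : ∀ ω ∈ Ω, CorrectlyClassifies I.y D (I.φ ω)) {ω : Euc s} (hω : ω ∈ Ω) (F : Set H) :
    CorrectlyClassifies I.y F (I.φ ω) ↔ (I.φ ω ∈ F ↔ I.φ ω ∈ D) := by
  obtain ⟨h1, h2⟩ := hD ω hω
  rcases hI.label ω hω with h | h
  · have := h1 h
    have h0 : ¬ (1 : ℝ) = -1 := by norm_num
    simp [CorrectlyClassifies, h, this, h0]
  · have := h2 h
    have h0 : ¬ (-1 : ℝ) = 1 := by norm_num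
    simp [CorrectlyClassifies, h, this, h0]

omit [InnerProductSpace ℝ H] in
/-- PAC learning from a finite family of encodings of all possible outputs. -/
theorem Regular.isPAC_of_encoding (hI : I.Regular Ω) (hφ : Continuous I.φ) {D : Set H}
    (hDm : IsClosed D) (hD : ∀ ω ∈ Ω, CorrectlyClassifies I.y D (I.φ ω))
    {returns : Finset (Euc s) → Set H → Prop} {m k : ℕ} {ι : Type*} [Fintype ι]
    (Q : ι → (Fin m → Euc s) → Set H) (J : ι → Finset (Fin m)) (hJ : ∀ σ, (J σ).card ≤ k)
    (hQ : ∀ σ, MeasurableSet {p : (Fin m → Euc s) × Euc s | I.φ p.2 ∈ Q σ p.1})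
    (hdep : ∀ σ w w', (∀ j ∈ J σ, w j = w' j) → Q σ w = Q σ w')
    (hcov : ∀ w : Fin m → Euc s, (∀ j, w j ∈ Ω) → ∀ F, returns (sampleSet w) F →
      I.ConsistentOn (sampleSet w) F ∧ ∃ σ, F = Q σ w)
    {ε δ : ℝ} (hε : 0 ≤ ε) (hε1 : ε ≤ 1)
    (hδ : Fintype.card ι * (1 - ε) ^ (m - k) ≤ δ) : I.IsPAC returns Ω ε δ m := by
  intro P hP hPΩ
  set B : ι → (Fin m → Euc s) → Set (Euc s) :=
    fun σ w => {x | ¬ (I.φ x ∈ Q σ w ↔ I.φ x ∈ D)} with hB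
  have hBm : ∀ σ, MeasurableSet {p : (Fin m → Euc s) × Euc s | p.2 ∈ B σ p.1} := by
    intro σ
    have h1 : MeasurableSet {p : (Fin m → Euc s) × Euc s | I.φ p.2 ∈ D} :=
      (hDm.preimage (hφ.comp continuous_snd)).measurableSet
    have h2 : {p : (Fin m → Euc s) × Euc s | p.2 ∈ B σ p.1} =
        ({p | I.φ p.2 ∈ Q σ p.1} ∩ {p | I.φ p.2 ∈ D}ᶜ) ∪
          ({p | I.φ p.2 ∈ Q σ p.1}ᶜ ∩ {p | I.φ p.2 ∈ D}) := by
      ext p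
      simp only [hB, Set.mem_ofPred_eq, Set.mem_union, Set.mem_inter_iff, Set.mem_compl_iff]
      tauto
    rw [h2]
    exact ((hQ σ).inter h1.compl).union ((hQ σ).compl.inter h1)
  have hmain := measure_pi_exists_consistent_le P J hJ hBm (fun σ w w' h => by
    simp only [hB, hdep σ w w' h]) hε hε1
  have hnull : Measure.pi (fun _ : Fin m => P) {w | ∃ j, w j ∉ Ω} = 0 := by
    have : {w : Fin m → Euc s | ∃ j, w j ∉ Ω} = ⋃ j, Function.eval j ⁻¹' Ωᶜ := by
      ext w; simp
    rw [this, measure_iUnion_null_iff]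
    intro j
    exact (measurePreserving_eval (fun _ : Fin m => P) j).quasiMeasurePreserving.preimage_null hPΩ
  -- The output need not depend measurably on the sample; the bad event is merely covered by a union
  -- over the encodings and a null set.
  have hsub : {w : Fin m → Euc s | ∃ F, returns (sampleSet w) F ∧
        ENNReal.ofReal ε < P {ω | ¬ CorrectlyClassifies I.y F (I.φ ω)}} ⊆
      {w | ∃ j, w j ∉ Ω} ∪
        {w | ∃ σ, ENNReal.ofReal ε < P (B σ w) ∧ ∀ j, w j ∉ B σ w} := by
    rintro w ⟨F, hF, hlt⟩
    by_cases hw : ∀ j, w j ∈ Ω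
    · right
      obtain ⟨hc, σ, rfl⟩ := hcov w hw F hF
      refine ⟨σ, hlt.trans_le ?_, fun j => ?_⟩
      · have h1 : {ω | ¬ CorrectlyClassifies I.y (Q σ w) (I.φ ω)} ⊆ B σ w ∪ Ωᶜ := by
          intro ω hω
          by_cases hωΩ : ω ∈ Ω
          · left
            exact fun h => hω ((correctlyClassifies_iff hI hD hωΩ _).2 h)
          · exact Or.inr hωΩ
        calc P _ ≤ P (B σ w ∪ Ωᶜ) := measure_mono h1
          _ ≤ P (B σ w) + P Ωᶜ := measure_union_le _ _
          _ = P (B σ w) := by rw [hPΩ, add_zero]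
      · have h1 := hc (w j) (by simp [sampleSet])
        exact fun h => h ((correctlyClassifies_iff hI hD (hw j) _).1 h1)
    · left
      push Not at hw
      exact hw
  calc _ ≤ _ := measure_mono hsub
    _ ≤ _ := measure_union_le _ _
    _ ≤ ENNReal.ofReal δ := by
      rw [hnull, zero_add]
      exact hmain.trans (ENNReal.ofReal_le_ofReal hδ)

theorem Derived.exists_list (hγ : 0 < I.γ) {X : Finset (Euc s)} {S : State H}
    (hS : I.Derived X S) {A : Type*} {g : A → Aff H} (hg : ∀ ω ∈ X, I.vec ω ∈ Set.range g) :
    ∃ l : List A, l.length ≤ ⌊256 / I.γ ^ 2⌋₊ ∧ S = decode I.β (l.map g) := by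
  obtain ⟨hb, l, hl, hlen, hS⟩ := hS
  have h1 : l.map I.vec ∈ Set.range (List.map g) := by
    rw [Set.range_list_map]
    intro v hv
    obtain ⟨ω, hω, rfl⟩ := List.mem_map.1 hv
    exact hg ω (hl ω hω)
  obtain ⟨l', hl'⟩ := h1
  refine ⟨l', ?_, by rw [hl']; exact hS⟩
  have h2 : l'.length = l.length := by simpa using congrArg List.length hl'
  rw [h2]
  exact Nat.le_floor (hlen.trans (energy_le hγ hb))

open scoped Classical in
/-- The vector `± (x^#, 1)`, with the sign given by membership of `φ(ω)` in `D`. -/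
noncomputable def vecOf (I : Impl s H) (D : Set H) (ω : Euc s) : Aff H :=
  WithLp.toLp 2 ((if I.φ ω ∈ D then (1 : ℝ) else -1) •
    (projBall (I.φ (latticePoint I.β ω)), (1 : ℝ)))

theorem vecOf_eq_vec (hI : I.Regular Ω) {D : Set H}
    (hD : ∀ ω ∈ Ω, CorrectlyClassifies I.y D (I.φ ω)) {ω : Euc s} (hω : ω ∈ Ω) :
    I.vecOf D ω = I.vec ω := by
  obtain ⟨h1, h2⟩ := hD ω hω
  rcases hI.label ω hω with h | h
  · simp [vecOf, vec, h, h1 h]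
  · simp [vecOf, vec, h, h2 h]

theorem stronglyMeasurable_vecOf (hφ : Continuous I.φ) {D : Set H} (hDm : IsClosed D) :
    StronglyMeasurable (I.vecOf D) := by
  classical
  have h1 : Measurable fun ω => if I.φ ω ∈ D then (1 : ℝ) else -1 :=
    Measurable.ite (hDm.preimage hφ).measurableSet measurable_const measurable_const
  have h2 := stronglyMeasurable_projBall
    (hφ.comp_stronglyMeasurable (measurable_latticePoint (s := s) I.β).stronglyMeasurable)
  exact (WithLp.prod_continuous_toLp 2 H ℝ).comp_stronglyMeasurable
    (h1.stronglyMeasurable.smul (h2.prodMk stronglyMeasurable_const))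

/-- Encodings list sample indices; each of the T q slots holds one of the m indices or `none`. -/
theorem Regular.isPAC_of_compression (hI : I.Regular Ω) (hφ : Continuous I.φ) {D : Set H}
    (hDm : IsClosed D) (hD : ∀ ω ∈ Ω, CorrectlyClassifies I.y D (I.φ ω))
    {returns : Finset (Euc s) → Set H → Prop} {T : ℕ} (hret : I.ReturnsDerived Ω returns T)
    {m : ℕ} {ε δ : ℝ} (hε : 0 ≤ ε) (hε1 : ε ≤ 1)
    (hδ : ((m : ℝ) + 1) ^ (T * ⌊256 / I.γ ^ 2⌋₊) *
      (1 - ε) ^ (m - T * ⌊256 / I.γ ^ 2⌋₊) ≤ δ) : I.IsPAC returns Ω ε δ m := by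
  set q := ⌊256 / I.γ ^ 2⌋₊ with hq
  have hmeas : ∀ j : Fin m, StronglyMeasurable fun w : Fin m → Euc s => I.vecOf D (w j) :=
    fun j => StronglyMeasurable.comp_measurable (g := fun w : Fin m → Euc s => w j)
      (stronglyMeasurable_vecOf hφ hDm) (measurable_pi_apply j)
  have hQ : ∀ σ : Fin T → Fin q → Option (Fin m), MeasurableSet {p : (Fin m → Euc s) × Euc s |
      I.φ p.2 ∈ polyOf I.β (fun j => I.vecOf D (p.1 j)) σ} := by
    intro σ
    exact measurableSet_polyOf (W := Fin m → Euc s) hφ (g := fun w j => I.vecOf D (w j)) hmeas σ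
  refine hI.isPAC_of_encoding hφ hDm hD (ι := Fin T → Fin q → Option (Fin m))
    (fun σ w => polyOf I.β (fun j => I.vecOf D (w j)) σ) support card_support_le
    hQ
    (fun σ w w' h => polyOf_congr fun i j a ha => by rw [h a (mem_support ha)]) ?_ hε hε1 ?_
  · intro w hw F hF
    have hX : ((sampleSet w : Finset (Euc s)) : Set (Euc s)) ⊆ Ω := by
      intro ω hω
      simp only [sampleSet, Finset.coe_image, Finset.coe_univ, Set.image_univ] at hω
      obtain ⟨j, rfl⟩ := hω
      exact hw j
    obtain ⟨hc, G, rfl, hT, hG⟩ := hret _ hX F hF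
    refine ⟨hc, exists_poly_eq_polyOf _ hT fun n hn => (hG n hn).exists_list hI.γ_pos ?_⟩
    intro ω hω
    simp only [sampleSet, Finset.mem_image, Finset.mem_univ, true_and] at hω
    obtain ⟨j, rfl⟩ := hω
    exact ⟨j, vecOf_eq_vec hI hD (hw j)⟩
  · have hcard : (Fintype.card (Fin T → Fin q → Option (Fin m)) : ℝ) =
        ((m : ℝ) + 1) ^ (T * q) := by
      simp [← pow_mul, mul_comm]
    rw [hcard]
    exact hδ

/-- The vectors `± (x^#, 1)` that come from the lattice points in the unit cube. -/
noncomputable def gridVec (I : Impl s H) {n : ℕ} (a : Bool × (Fin s → Fin n)) : Aff H :=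
  WithLp.toLp 2 ((if a.1 then (1 : ℝ) else -1) •
    (projBall (I.φ (WithLp.toLp 2 fun i => I.β * (a.2 i : ℝ))), (1 : ℝ)))

theorem Regular.vec_mem_range_gridVec (hI : I.Regular Ω)
    (hΩ : ∀ ω ∈ Ω, ∀ i, ω i ∈ Set.Icc (0 : ℝ) 1) {ω : Euc s} (hω : ω ∈ Ω) :
    I.vec ω ∈ Set.range (I.gridVec (n := ⌊1 / I.β⌋₊ + 2)) := by
  have hβ := hI.β_pos
  -- Rounding [0,1] produces the multiples 0, ..., ⌊1/β⌋ + 1 of β at most.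
  have hr : ∀ i, ∃ j : Fin (⌊1 / I.β⌋₊ + 2), ((j : ℕ) : ℤ) = round (ω i / I.β) := by
    intro i
    obtain ⟨h0, h1⟩ := hΩ ω hω i
    have h3 : (0 : ℤ) ≤ round (ω i / I.β) := by
      rw [round_eq]
      apply Int.floor_nonneg.2
      have := div_nonneg h0 hβ.le
      linarith
    have h4 : round (ω i / I.β) < ((⌊1 / I.β⌋₊ + 2 : ℕ) : ℤ) := by
      rw [round_eq, Int.floor_lt]
      have h5 : ω i / I.β ≤ 1 / I.β := by gcongr
      have h6 := Nat.lt_floor_add_one (1 / I.β)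
      push_cast
      linarith
    refine ⟨⟨(round (ω i / I.β)).toNat, ?_⟩, ?_⟩
    · zify
      rw [Int.toNat_of_nonneg h3]
      exact_mod_cast h4
    · simp [Int.toNat_of_nonneg h3]
  choose j hj using hr
  have hl : (WithLp.toLp 2 fun i => I.β * ((j i : ℕ) : ℝ) : Euc s) = latticePoint I.β ω := by
    unfold latticePoint
    congr 1
    funext i
    rw [← hj i]
    simp
  rcases hI.label ω hω with h | h
  · refine ⟨(true, j), ?_⟩
    simp [gridVec, vec, h, hl]
  · refine ⟨(false, j), ?_⟩
    simp [gridVec, vec, h, hl]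

/-- The encodings refer to a fixed finite set of vectors, so no draws are spent on describing the
output and the exponent is the full m. -/
theorem Regular.isPAC_of_grid (hI : I.Regular Ω) (hφ : Continuous I.φ) {D : Set H}
    (hDm : IsClosed D) (hD : ∀ ω ∈ Ω, CorrectlyClassifies I.y D (I.φ ω))
    (hΩ : ∀ ω ∈ Ω, ∀ i, ω i ∈ Set.Icc (0 : ℝ) 1)
    {returns : Finset (Euc s) → Set H → Prop} {T : ℕ} (hret : I.ReturnsDerived Ω returns T)
    {m : ℕ} {ε δ : ℝ} (hε : 0 ≤ ε) (hε1 : ε ≤ 1)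
    (hδ : (2 * ((⌊1 / I.β⌋₊ : ℝ) + 2) ^ s + 1) ^ (T * ⌊256 / I.γ ^ 2⌋₊) * (1 - ε) ^ m ≤ δ) :
    I.IsPAC returns Ω ε δ m := by
  set q := ⌊256 / I.γ ^ 2⌋₊ with hq
  set n := ⌊1 / I.β⌋₊ + 2 with hn
  refine hI.isPAC_of_encoding hφ hDm hD
    (ι := Fin T → Fin q → Option (Bool × (Fin s → Fin n))) (k := 0)
    (fun σ _ => polyOf I.β I.gridVec σ) (fun _ => ∅) (by simp)
    (fun σ => measurableSet_polyOf hφ (g := fun _ a => I.gridVec a)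
      (fun _ => stronglyMeasurable_const) σ)
    (fun _ _ _ _ => rfl) ?_ hε hε1 ?_
  · intro w hw F hF
    have hX : ((sampleSet w : Finset (Euc s)) : Set (Euc s)) ⊆ Ω := by
      intro ω hω
      simp only [sampleSet, Finset.coe_image, Finset.coe_univ, Set.image_univ] at hω
      obtain ⟨j, rfl⟩ := hω
      exact hw j
    obtain ⟨hc, G, rfl, hT, hG⟩ := hret _ hX F hF
    exact ⟨hc, exists_poly_eq_polyOf _ hT fun n hn => (hG n hn).exists_list hI.γ_pos
      fun ω hω => hI.vec_mem_range_gridVec hΩ (hX hω)⟩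
  · have hcard : (Fintype.card (Fin T → Fin q → Option (Bool × (Fin s → Fin n))) : ℝ) =
        (2 * ((⌊1 / I.β⌋₊ : ℝ) + 2) ^ s + 1) ^ (T * q) := by
      simp [← pow_mul, mul_comm, hn]
    rw [hcard]
    exact hδ

end Impl

/-! ### Estimates for the sample size -/

theorem one_sub_pow_le_exp {ε : ℝ} (hε : ε ≤ 1) (n : ℕ) :
    (1 - ε) ^ n ≤ Real.exp (-(ε * n)) := by
  calc (1 - ε) ^ n ≤ Real.exp (-ε) ^ n :=
        pow_le_pow_left₀ (by linarith) (Real.one_sub_le_exp_neg ε) n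
    _ = Real.exp (-(ε * n)) := by rw [← Real.exp_nat_mul]; congr 1; ring

theorem compression_estimate {κ : ℕ} {K ε δ : ℝ} (hκ : 1 ≤ κ) (hK : (κ : ℝ) ≤ K) (hε : 0 < ε)
    (hε1 : ε < 1 / 2) (hδ : 0 < δ) {m : ℕ}
    (hm : 2 / ε * (K * Real.log (4 * K / ε) + Real.log (1 / δ)) ≤ m) :
    ((m : ℝ) + 1) ^ κ * (1 - ε) ^ (m - κ) ≤ δ := by
  have hκ0 : (1 : ℝ) ≤ κ := by exact_mod_cast hκ
  have hκp : (0 : ℝ) < κ := by linarith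
  have hm1 : (0 : ℝ) < (m : ℝ) + 1 := by positivity
  have h1 : κ * Real.log (4 * κ / ε) ≤ K * Real.log (4 * K / ε) := by
    have h2 : Real.log (4 * κ / ε) ≤ Real.log (4 * K / ε) := by
      apply Real.log_le_log (by positivity)
      gcongr
    have h3 : 0 ≤ Real.log (4 * κ / ε) := by
      apply Real.log_nonneg
      rw [le_div_iff₀ hε]
      linarith
    exact mul_le_mul hK h2 h3 (by linarith)
  have h4 : 2 * (κ * Real.log (4 * κ / ε) + Real.log (1 / δ)) ≤ ε * m := by
    rw [div_mul_eq_mul_div, div_le_iff₀ hε] at hm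
    linarith
  -- From log x ≤ x - 1 at x = ε(m+1)/(4κ); multiplied by κ, the linear term uses only a quarter of
  -- ε(m+1).
  have h5 : Real.log (m + 1) ≤ ε / (4 * κ) * (m + 1) - 1 + Real.log (4 * κ / ε) := by
    have h6 := Real.log_le_sub_one_of_pos (x := ε / (4 * κ) * (m + 1)) (by positivity)
    rw [Real.log_mul (by positivity) (by positivity), ← inv_div, Real.log_inv] at h6
    rw [← inv_div]
    linarith
  have h7 : κ * Real.log (m + 1) ≤ ε * (m + 1) / 4 - κ + κ * Real.log (4 * κ / ε) := by
    calc κ * Real.log (m + 1) ≤ κ * (ε / (4 * κ) * (m + 1) - 1 + Real.log (4 * κ / ε)) := by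
          gcongr
      _ = _ := by field_simp
  have h8 : (m : ℝ) - κ ≤ ((m - κ : ℕ) : ℝ) := by
    have : (m : ℝ) ≤ ((m - κ + κ : ℕ) : ℝ) := by exact_mod_cast (by omega : m ≤ m - κ + κ)
    push_cast at this
    linarith
  have h9 : ε * (m - κ) ≤ ε * ((m - κ : ℕ) : ℝ) := by gcongr
  have hlogδ : Real.log (1 / δ) = -Real.log δ := by rw [one_div, Real.log_inv]
  calc ((m : ℝ) + 1) ^ κ * (1 - ε) ^ (m - κ)
      ≤ Real.exp (κ * Real.log (m + 1)) * Real.exp (-(ε * (m - κ : ℕ))) := by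
        have : 0 ≤ (1 - ε) ^ (m - κ) := pow_nonneg (by linarith) _
        gcongr
        · rw [Real.exp_nat_mul, Real.exp_log hm1]
        · exact one_sub_pow_le_exp (by linarith) _
    _ = Real.exp (κ * Real.log (m + 1) + -(ε * (m - κ : ℕ))) := by rw [Real.exp_add]
    _ ≤ Real.exp (Real.log δ) := by
        rw [Real.exp_le_exp]
        have : 0 ≤ κ * Real.log (4 * κ / ε) := by
          refine mul_nonneg hκp.le (Real.log_nonneg ?_)
          rw [le_div_iff₀ hε]
          linarith
        nlinarith
    _ = δ := Real.exp_log hδ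

theorem finite_class_estimate {κ : ℕ} {K b Λ ε δ : ℝ} (hK : (κ : ℝ) ≤ K) (hb : 1 ≤ b)
    (hΛ : Real.log b ≤ Λ) (hε : 0 < ε) (hε1 : ε ≤ 1) (hδ : 0 < δ) {m : ℕ}
    (hm : 1 / ε * (K * Λ + Real.log (1 / δ)) ≤ m) :
    b ^ κ * (1 - ε) ^ m ≤ δ := by
  have h0 := Real.log_nonneg hb
  have h1 : κ * Real.log b ≤ K * Λ := by
    have : (0 : ℝ) ≤ κ := by positivity
    exact mul_le_mul hK hΛ h0 (by linarith)
  have h4 : K * Λ + Real.log (1 / δ) ≤ ε * m := by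
    rw [div_mul_eq_mul_div, div_le_iff₀ hε] at hm
    linarith
  have hlogδ : Real.log (1 / δ) = -Real.log δ := by rw [one_div, Real.log_inv]
  calc b ^ κ * (1 - ε) ^ m ≤ Real.exp (κ * Real.log b) * Real.exp (-(ε * m)) := by
        have : 0 ≤ (1 - ε) ^ m := pow_nonneg (by linarith) _
        gcongr
        · rw [Real.exp_nat_mul, Real.exp_log (by linarith)]
        · exact one_sub_pow_le_exp hε1 _
    _ = Real.exp (κ * Real.log b + -(ε * m)) := by rw [Real.exp_add]
    _ ≤ Real.exp (Real.log δ) := by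
        rw [Real.exp_le_exp]
        linarith
    _ = δ := Real.exp_log hδ

theorem log_grid_le {β : ℝ} (hβ : 0 < β) (hβ1 : β ≤ 1 / 50) {s : ℕ} (hs : 1 ≤ s) :
    Real.log (2 * ((⌊1 / β⌋₊ : ℝ) + 2) ^ s + 1) ≤ 3 * s * Real.log (1 / β) := by
  have h1 : (50 : ℝ) ≤ 1 / β := by rw [le_div_iff₀ hβ]; linarith
  set x := 1 / β with hx
  have h2 : (⌊x⌋₊ : ℝ) ≤ x := Nat.floor_le (by linarith)
  have h3 : (1 : ℝ) ≤ (x ^ 2) ^ s := one_le_pow₀ (by nlinarith)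
  have h4 : ((⌊x⌋₊ : ℝ) + 2) ^ s ≤ (x ^ 2) ^ s := by
    gcongr
    nlinarith
  have h5 : x ≤ x ^ s := le_self_pow₀ (by linarith) (by omega)
  calc Real.log (2 * ((⌊x⌋₊ : ℝ) + 2) ^ s + 1) ≤ Real.log (x ^ (3 * s)) := by
        apply Real.log_le_log (by positivity)
        have e : x ^ (3 * s) = (x ^ 2) ^ s * x ^ s := by rw [← pow_mul, ← pow_add]; congr 1; ring
        rw [e]
        nlinarith
    _ = 3 * s * Real.log x := by rw [Real.log_pow]; push_cast; ring

end RKHSPoly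

namespace RKHSPoly

variable {s : ℕ} {H : Type*} [NormedAddCommGroup H] [InnerProductSpace ℝ H]

theorem isClosed_iInter_halfspace {t : ℕ} (h : Fin t → H) (d : Fin t → ℝ) :
    IsClosed (⋂ i, halfspace (h i) (d i)) := by
  refine isClosed_iInter fun i => ?_
  unfold halfspace
  exact isClosed_le continuous_const (by fun_prop)

theorem half_le_log_of_two_le {x : ℝ} (hx : 2 ≤ x) : 69 / 100 ≤ Real.log x := by
  have := Real.log_le_log two_pos hx
  linarith [Real.log_two_gt_d9]

theorem le_of_scaled_le {C a ε X Y m : ℝ} (hε : 0 < ε) (h : C / ε * X ≤ m) (hXY : a * Y ≤ C * X) :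
    a / ε * Y ≤ m := by
  refine le_trans ?_ h
  rw [div_mul_eq_mul_div, div_mul_eq_mul_div]
  gcongr

theorem proper_sample_size {r ε l : ℝ} (hr : 0 < r) (hε : 0 < ε) (hε1 : ε < 1 / 2) (hl : 0 ≤ l) :
    2 * (256 * r * Real.log (4 * (256 * r) / ε) + l) ≤
      20000 * (r * Real.log (2 + r) * Real.log (1 / ε) + l) := by
  have ha : 69 / 100 ≤ Real.log (2 + r) := half_le_log_of_two_le (by linarith)
  have hb : 69 / 100 ≤ Real.log (1 / ε) :=
    half_le_log_of_two_le (by rw [le_div_iff₀ hε]; linarith)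
  have h1 : Real.log r ≤ Real.log (2 + r) := Real.log_le_log hr (by linarith)
  have h2 : Real.log 1024 ≤ 7 := by
    rw [show (1024 : ℝ) = 2 ^ 10 by norm_num, Real.log_pow]
    push_cast
    linarith [Real.log_two_lt_d9]
  have h3 : Real.log (4 * (256 * r) / ε) = Real.log 1024 + Real.log r + Real.log (1 / ε) := by
    rw [← Real.log_mul (by norm_num) hr.ne', ← Real.log_mul (by positivity) (by positivity)]
    congr 1
    ring
  set a := Real.log (2 + r)
  set b := Real.log (1 / ε)
  -- As a, b ≥ 69/100, the sum 7 + a + b is at most 18ab.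
  have h4 : Real.log (4 * (256 * r) / ε) ≤ 18 * (a * b) := by
    rw [h3]
    nlinarith [mul_nonneg (sub_nonneg.2 ha) (sub_nonneg.2 hb)]
  have h5 : r * Real.log (4 * (256 * r) / ε) ≤ r * (18 * (a * b)) := by gcongr
  have h6 : 0 ≤ r * (a * b) := by positivity
  nlinarith

/-- The crude bound log(4K) ≤ 4K squares `K`, which for K = (t+1)^(O(γ⁻²)) only changes the constant
in the exponent. -/
theorem improper_sample_size {K ε l : ℝ} (hK : 1 ≤ K) (hε : 0 < ε) (hε1 : ε < 1 / 2)
    (hl : 0 ≤ l) :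
    2 * (K * Real.log (4 * K / ε) + l) ≤ 20000 * (K ^ 2 * Real.log (1 / ε) + l) := by
  have hb : 69 / 100 ≤ Real.log (1 / ε) :=
    half_le_log_of_two_le (by rw [le_div_iff₀ hε]; linarith)
  have h1 : Real.log (4 * K) ≤ 4 * K := (Real.log_le_self (by linarith))
  have h3 : Real.log (4 * K / ε) = Real.log (4 * K) + Real.log (1 / ε) := by
    rw [← Real.log_mul (by positivity) (by positivity)]
    congr 1
    ring
  set b := Real.log (1 / ε)
  have h4 : Real.log (4 * K / ε) ≤ 7 * (K * b) := by
    rw [h3]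
    nlinarith
  have h5 : K * Real.log (4 * K / ε) ≤ K * (7 * (K * b)) := by gcongr
  have h6 : 0 ≤ K ^ 2 * b := by positivity
  nlinarith

/-- For a = 1/γ² this absorbs the number of updates per node into the exponent; γ ≤ 2 becomes a ≥
1/4. -/
theorem rpow_mul_le_rpow {T a : ℝ} (hT : 2 ≤ T) (ha : 1 / 4 ≤ a) :
    T ^ (768 * a) * (256 * a) ≤ T ^ (868 * a) := by
  have hT0 : 0 < T := by linarith
  have h1 : 256 * a ≤ T ^ (100 * a) := by
    have h2 : 69 / 100 ≤ Real.log T := half_le_log_of_two_le hT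
    calc 256 * a ≤ (32 * a + 1) ^ 2 := by nlinarith
      _ ≤ Real.exp (32 * a) ^ 2 := by
        gcongr
        exact Real.add_one_le_exp _
      _ = Real.exp (64 * a) := by rw [← Real.exp_nat_mul]; congr 1; push_cast; ring
      _ ≤ Real.exp (Real.log T * (100 * a)) := by
        rw [Real.exp_le_exp]
        nlinarith
      _ = T ^ (100 * a) := by rw [Real.rpow_def_of_pos hT0]
  calc T ^ (768 * a) * (256 * a) ≤ T ^ (768 * a) * T ^ (100 * a) := by gcongr
    _ = T ^ (868 * a) := by rw [← Real.rpow_add hT0]; congr 1; ring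

/-! ### Sample complexity of the two algorithms -/

namespace Impl

variable {I : Impl s H} {Ω : Set (Euc s)}

omit [InnerProductSpace ℝ H] in
theorem Regular.one_le_floor (hI : I.Regular Ω) : 1 ≤ ⌊256 / I.γ ^ 2⌋₊ := by
  have hγ := hI.γ_pos
  have hγ2 := hI.γ_le
  apply Nat.le_floor
  rw [Nat.cast_one, le_div_iff₀ (by positivity)]
  nlinarith

omit [InnerProductSpace ℝ H] in
theorem Regular.β_le' (hI : I.Regular Ω) : I.β ≤ 1 / 50 := by
  have h1 := hI.β_le
  have h2 := hI.γ_pos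
  have h3 := hI.γ_le
  nlinarith

theorem Regular.isPAC_proper (hI : I.Regular Ω) (hφ : Continuous I.φ) {D : Set H}
    (hDm : IsClosed D) (hD : ∀ ω ∈ Ω, CorrectlyClassifies I.y D (I.φ ω)) {t : ℕ} (ht : 1 ≤ t)
    {ε δ : ℝ} (hε : 0 < ε) (hε1 : ε < 1 / 2) (hδ : 0 < δ) (hδ1 : δ < 1 / 2) {m : ℕ}
    (hm : 20000 / ε * (t / I.γ ^ 2 * Real.log (2 + t / I.γ ^ 2) * Real.log (1 / ε) +
      Real.log (1 / δ)) ≤ m) :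
    I.IsPAC (I.ProperReturns t) Ω ε δ m := by
  have hγ := hI.γ_pos
  have ht0 : (0 : ℝ) < t := by exact_mod_cast ht
  have hl : 0 ≤ Real.log (1 / δ) := Real.log_nonneg (by rw [le_div_iff₀ hδ]; linarith)
  refine hI.isPAC_of_compression hφ hDm hD (T := t) (fun X hX F hF => hI.properReturns_spec hX hF)
    hε.le (by linarith) ?_
  refine compression_estimate (K := 256 * (t / I.γ ^ 2))
    (Nat.mul_pos ht hI.one_le_floor) ?_ hε hε1 hδ ?_
  · push_cast
    calc (t : ℝ) * (⌊256 / I.γ ^ 2⌋₊ : ℝ) ≤ t * (256 / I.γ ^ 2) := by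
          gcongr
          exact Nat.floor_le (by positivity)
      _ = _ := by ring
  · exact le_of_scaled_le hε hm (proper_sample_size (by positivity) hε hε1 hl)

theorem Regular.isPAC_proper_grid (hI : I.Regular Ω) (hφ : Continuous I.φ) {D : Set H}
    (hDm : IsClosed D) (hD : ∀ ω ∈ Ω, CorrectlyClassifies I.y D (I.φ ω)) (hs : 1 ≤ s)
    (hΩ : ∀ ω ∈ Ω, ∀ i, ω i ∈ Set.Icc (0 : ℝ) 1) {t : ℕ}
    {ε δ : ℝ} (hε : 0 < ε) (hε1 : ε < 1 / 2) (hδ : 0 < δ) (hδ1 : δ < 1 / 2) {m : ℕ}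
    (hm : 20000 / ε * (s * t / I.γ ^ 2 * Real.log (1 / I.β) + Real.log (1 / δ)) ≤ m) :
    I.IsPAC (I.ProperReturns t) Ω ε δ m := by
  have hγ := hI.γ_pos
  have hβ := hI.β_pos
  have hl : 0 ≤ Real.log (1 / δ) := Real.log_nonneg (by rw [le_div_iff₀ hδ]; linarith)
  have hlb : 0 ≤ Real.log (1 / I.β) :=
    Real.log_nonneg (by rw [le_div_iff₀ hβ]; linarith [hI.β_le'])
  refine hI.isPAC_of_grid hφ hDm hD hΩ (T := t) (fun X hX F hF => hI.properReturns_spec hX hF)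
    hε.le (by linarith) ?_
  refine finite_class_estimate (K := 256 * (t / I.γ ^ 2)) ?_
    (le_add_of_nonneg_left (by positivity)) (log_grid_le hβ hI.β_le' hs) hε (by linarith) hδ ?_
  · push_cast
    calc (t : ℝ) * (⌊256 / I.γ ^ 2⌋₊ : ℝ) ≤ t * (256 / I.γ ^ 2) := by
          gcongr
          exact Nat.floor_le (by positivity)
      _ = _ := by ring
  · refine le_of_scaled_le hε hm ?_
    have h0 : 0 ≤ s * t / I.γ ^ 2 * Real.log (1 / I.β) := by positivity
    calc 1 * (256 * (t / I.γ ^ 2) * (3 * s * Real.log (1 / I.β)) + Real.log (1 / δ))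
        = 768 * (s * t / I.γ ^ 2 * Real.log (1 / I.β)) + Real.log (1 / δ) := by ring
      _ ≤ _ := by linarith

omit [InnerProductSpace ℝ H] in
theorem Regular.improper_size (hI : I.Regular Ω) {t : ℕ} (ht : 1 ≤ t) :
    1 ≤ ⌊((t : ℝ) + 1) ^ (768 / I.γ ^ 2)⌋₊ * ⌊256 / I.γ ^ 2⌋₊ ∧
    ((⌊((t : ℝ) + 1) ^ (768 / I.γ ^ 2)⌋₊ * ⌊256 / I.γ ^ 2⌋₊ : ℕ) : ℝ) ≤
      ((t : ℝ) + 1) ^ (868 / I.γ ^ 2) ∧ 1 ≤ ((t : ℝ) + 1) ^ (868 / I.γ ^ 2) ∧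
    (((t : ℝ) + 1) ^ (868 / I.γ ^ 2)) ^ 2 ≤ ((t : ℝ) + 1) ^ (20000 / I.γ ^ 2) := by
  have hγ := hI.γ_pos
  have hγ2 := hI.γ_le
  have ht1 : (1 : ℝ) ≤ t := by exact_mod_cast ht
  have ha : 1 / 4 ≤ 1 / I.γ ^ 2 := by
    rw [div_le_div_iff₀ (by norm_num) (by positivity)]
    nlinarith
  have e : ∀ x : ℝ, x / I.γ ^ 2 = x * (1 / I.γ ^ 2) := fun x => by ring
  have h1 : 1 ≤ ((t : ℝ) + 1) ^ (768 / I.γ ^ 2) :=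
    Real.one_le_rpow (by linarith) (by positivity)
  refine ⟨Nat.mul_pos (Nat.le_floor (by exact_mod_cast h1)) hI.one_le_floor, ?_,
    Real.one_le_rpow (by linarith) (by positivity), ?_⟩
  · push_cast
    refine le_trans ?_ ((rpow_mul_le_rpow (by linarith : (2 : ℝ) ≤ t + 1) ha).trans_eq
      (by rw [← e]))
    rw [← e, ← e]
    gcongr
    · exact Nat.floor_le (by positivity)
    · exact Nat.floor_le (by positivity)
  · rw [← Real.rpow_mul_natCast (by linarith)]
    refine Real.rpow_le_rpow_of_exponent_le (by linarith) ?_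
    rw [div_mul_eq_mul_div]
    gcongr
    norm_num

theorem Regular.returnsDerived_improper (hI : I.Regular Ω) {t : ℕ} (ht : 1 ≤ t)
    (hsep : I.Separable Ω t) :
    I.ReturnsDerived Ω I.ImproperReturns ⌊((t : ℝ) + 1) ^ (768 / I.γ ^ 2)⌋₊ := by
  intro X hX F hF
  obtain ⟨h1, G, h2, h3, h4⟩ := hI.improperReturns_spec hX ht hsep hF
  exact ⟨h1, G, h2, Nat.le_floor h3, h4⟩

theorem Regular.isPAC_improper (hI : I.Regular Ω) (hφ : Continuous I.φ) {D : Set H}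
    (hDm : IsClosed D) (hD : ∀ ω ∈ Ω, CorrectlyClassifies I.y D (I.φ ω)) {t : ℕ} (ht : 1 ≤ t)
    (hsep : I.Separable Ω t)
    {ε δ : ℝ} (hε : 0 < ε) (hε1 : ε < 1 / 2) (hδ : 0 < δ) (hδ1 : δ < 1 / 2) {m : ℕ}
    (hm : 20000 / ε * (((t : ℝ) + 1) ^ (20000 / I.γ ^ 2) * Real.log (1 / ε) +
      Real.log (1 / δ)) ≤ m) :
    I.IsPAC I.ImproperReturns Ω ε δ m := by
  have hl : 0 ≤ Real.log (1 / δ) := Real.log_nonneg (by rw [le_div_iff₀ hδ]; linarith)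
  have hlε : 0 ≤ Real.log (1 / ε) := Real.log_nonneg (by rw [le_div_iff₀ hε]; linarith)
  obtain ⟨k1, k2, k3, k4⟩ := hI.improper_size ht
  refine hI.isPAC_of_compression hφ hDm hD (hI.returnsDerived_improper ht hsep) hε.le
    (by linarith) (compression_estimate k1 k2 hε hε1 hδ ?_)
  refine le_of_scaled_le hε hm ((improper_sample_size k3 hε hε1 hl).trans ?_)
  gcongr

theorem Regular.isPAC_improper_grid (hI : I.Regular Ω) (hφ : Continuous I.φ) {D : Set H}
    (hDm : IsClosed D) (hD : ∀ ω ∈ Ω, CorrectlyClassifies I.y D (I.φ ω)) (hs : 1 ≤ s)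
    (hΩ : ∀ ω ∈ Ω, ∀ i, ω i ∈ Set.Icc (0 : ℝ) 1) {t : ℕ} (ht : 1 ≤ t) (hsep : I.Separable Ω t)
    {ε δ : ℝ} (hε : 0 < ε) (hε1 : ε < 1 / 2) (hδ : 0 < δ) (hδ1 : δ < 1 / 2) {m : ℕ}
    (hm : 20000 / ε * (s * ((t : ℝ) + 1) ^ (20000 / I.γ ^ 2) * Real.log (1 / I.β) +
      Real.log (1 / δ)) ≤ m) :
    I.IsPAC I.ImproperReturns Ω ε δ m := by
  have hβ := hI.β_pos
  have hl : 0 ≤ Real.log (1 / δ) := Real.log_nonneg (by rw [le_div_iff₀ hδ]; linarith)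
  have hlb : 0 ≤ Real.log (1 / I.β) :=
    Real.log_nonneg (by rw [le_div_iff₀ hβ]; linarith [hI.β_le'])
  obtain ⟨-, k2, k3, k4⟩ := hI.improper_size ht
  refine hI.isPAC_of_grid hφ hDm hD hΩ (hI.returnsDerived_improper ht hsep) hε.le
    (by linarith) ?_
  refine finite_class_estimate k2 (le_add_of_nonneg_left (by positivity))
    (log_grid_le hβ hI.β_le' hs) hε (by linarith) hδ ?_
  refine le_of_scaled_le hε hm ?_
  set K := ((t : ℝ) + 1) ^ (868 / I.γ ^ 2)
  set K' := ((t : ℝ) + 1) ^ (20000 / I.γ ^ 2)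
  have hKK' : K ≤ K' := by nlinarith
  have h0 : 0 ≤ s * Real.log (1 / I.β) := by positivity
  have h1 : K * (s * Real.log (1 / I.β)) ≤ K' * (s * Real.log (1 / I.β)) := by gcongr
  have h2 : 0 ≤ K' * (s * Real.log (1 / I.β)) := by
    have : 0 ≤ K' := by linarith
    positivity
  nlinarith

end Impl

end RKHSPoly

theorem corollary2 :
    ∃ C c : ℝ, 0 < C ∧ 0 < c ∧
    ∀ (s : ℕ) (_ : 1 ≤ s) (H : Type*) [NormedAddCommGroup H] [InnerProductSpace ℝ H]
      [CompleteSpace H] [RKHS ℝ H (RKHSPoly.Euc s) ℝ]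
      (_ : Continuous fun p : RKHSPoly.Euc s × RKHSPoly.Euc s =>
        RKHSPoly.scalarKernel H p.1 p.2)
      (Ω : Set (RKHSPoly.Euc s)) (_ : IsCompact Ω)
      (_ : ∀ ω ∈ Ω, ‖RKHSPoly.featureMap H ω‖ ≤ 1)
      (y : H → ℝ) (_ : ∀ ω ∈ Ω, y (RKHSPoly.featureMap H ω) = 1 ∨
        y (RKHSPoly.featureMap H ω) = -1)
      (γ : ℝ) (_ : 0 < γ) (_ : γ ≤ 2) (t : ℕ) (_ : 1 ≤ t)
      (_ : ∃ (h : Fin t → H) (d : Fin t → ℝ),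
        RKHSPoly.GammaSeparates (RKHSPoly.featureMap H '' Ω) y γ h d),
      -- all sufficiently small steps are admissible
      (∃ β₀ > 0, ∀ β, 0 < β → β ≤ β₀ →
        RKHSPoly.AdmissibleStep (RKHSPoly.featureMap H) Ω γ c β) ∧
      -- explicit admissible steps for a Lipschitz kernel on the unit cube
      (∀ L : ℝ, 0 ≤ L → (∀ ω ∈ Ω, ∀ i, ω i ∈ Set.Icc (0 : ℝ) 1) →
        (∀ a b b' : RKHSPoly.Euc s, (∀ i, a i ∈ Set.Icc (0 : ℝ) 2) →
          (∀ i, b i ∈ Set.Icc (0 : ℝ) 2) → (∀ i, b' i ∈ Set.Icc (0 : ℝ) 2) →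
          |RKHSPoly.scalarKernel H a b - RKHSPoly.scalarKernel H a b'| ≤ L * ‖b - b'‖) →
        ∀ β, 0 < β → β ≤ c ^ 2 * γ ^ 2 / (1 + √(s : ℝ) * L) →
          RKHSPoly.AdmissibleStep (RKHSPoly.featureMap H) Ω γ c β) ∧
      -- both algorithms, implemented with an admissible step
      (∀ I : RKHSPoly.Impl s H, I.φ = RKHSPoly.featureMap H → I.y = y → I.γ = γ →
        RKHSPoly.AdmissibleStep (RKHSPoly.featureMap H) Ω γ c I.β →
        -- on every finite sample they stop and return consistent polyhedra
        (∀ X : Finset (RKHSPoly.Euc s), (X : Set (RKHSPoly.Euc s)) ⊆ Ω →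
          I.ProperHaltsWithin (C * t / γ ^ 2) (C / γ ^ 2) t X ∧
          (∃ F, I.ProperReturns t X F) ∧
          (∀ F, I.ProperReturns t X F →
            I.ConsistentOn X F ∧ ∃ t' ≤ t, RKHSPoly.IsPolyhedron t' F) ∧
          I.ImproperHaltsWithin (C * t / γ ^ 2) (C / γ ^ 2) X ∧
          (∃ F, I.ImproperReturns X F) ∧
          (∀ F, I.ImproperReturns X F →
            I.ConsistentOn X F ∧
              ∃ t' : ℕ, (t' : ℝ) ≤ ((t : ℝ) + 1) ^ (C / γ ^ 2) ∧
                RKHSPoly.IsPolyhedron t' F)) ∧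
        -- sample complexity
        (∀ ε δ : ℝ, 0 < ε → ε < 1 / 2 → 0 < δ → δ < 1 / 2 → ∀ m : ℕ,
          (C / ε * (t / γ ^ 2 * Real.log (2 + t / γ ^ 2) * Real.log (1 / ε) +
              Real.log (1 / δ)) ≤ m →
            I.IsPAC (I.ProperReturns t) Ω ε δ m) ∧
          (C / ε * (((t : ℝ) + 1) ^ (C / γ ^ 2) * Real.log (1 / ε) +
              Real.log (1 / δ)) ≤ m →
            I.IsPAC I.ImproperReturns Ω ε δ m) ∧
          ((∀ ω ∈ Ω, ∀ i, ω i ∈ Set.Icc (0 : ℝ) 1) →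
            (C / ε * (s * t / γ ^ 2 * Real.log (1 / I.β) + Real.log (1 / δ)) ≤ m →
              I.IsPAC (I.ProperReturns t) Ω ε δ m) ∧
            (C / ε * (s * ((t : ℝ) + 1) ^ (C / γ ^ 2) * Real.log (1 / I.β) +
                Real.log (1 / δ)) ≤ m →
              I.IsPAC I.ImproperReturns Ω ε δ m)))) := by
  -- The value 1/200 is dictated by the rounding estimate. Among the lower bounds on `C` are 2 · 868
  -- from the squared node bound and 2 · 256 · 18 from the proper sample size.
  refine ⟨20000, 1 / 200, by norm_num, by norm_num, ?_⟩
  intro s hs H _ _ _ _ hK Ω hΩ hball y hy γ hγ hγ2 t ht hsep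
  have hcont := RKHSPoly.continuous_featureMap hK
  refine ⟨RKHSPoly.exists_admissibleStep hcont hΩ hγ (by norm_num), ?_, ?_⟩
  · intro L hL hcube hLip β hβ hβ'
    exact RKHSPoly.admissibleStep_of_lipschitz hγ hγ2 (by norm_num) (by norm_num) hL hcube hLip
      hβ hβ'
  · intro I hφ hIy hIγ hadm
    subst hIy hIγ
    rw [← hφ] at hball hy hsep hadm hcont
    obtain ⟨h, d, hsep⟩ := hsep
    have hI : I.Regular Ω :=
      ⟨hball, hy, hγ, hγ2, hadm.1, by linarith [hadm.2.1], fun ω hω => by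
        linarith [hadm.2.2 ω hω]⟩
    have hS := hI.separable hsep
    -- The target polyhedron is the closed set that stands in for the labels.
    have hD := RKHSPoly.isClosed_iInter_halfspace h d
    have hDc : ∀ ω ∈ Ω, RKHSPoly.CorrectlyClassifies I.y
        (⋂ i, RKHSPoly.halfspace (h i) (d i)) (I.φ ω) :=
      fun ω hω => hsep.1 _ (Set.mem_image_of_mem _ hω)
    have hM : 256 * t / I.γ ^ 2 ≤ 20000 * t / I.γ ^ 2 := by gcongr; norm_num
    have hN : 256 / I.γ ^ 2 + 1 ≤ 20000 / I.γ ^ 2 := by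
      rw [div_add_one (by positivity)]
      gcongr
      nlinarith
    refine ⟨fun X hX => ⟨hI.properHaltsWithin hX hS hM hN, hI.exists_properReturns hX hS, ?_,
      hI.improperHaltsWithin hX hS hM hN, hI.exists_improperReturns hX hS, ?_⟩, ?_⟩
    · intro F hF
      obtain ⟨h1, G, rfl, h3, -⟩ := hI.properReturns_spec hX hF
      exact ⟨h1, _, h3, RKHSPoly.Impl.isPolyhedron_poly G⟩
    · intro F hF
      obtain ⟨h1, G, rfl, h3, -⟩ := hI.improperReturns_spec hX ht hS hF
      refine ⟨h1, _, h3.trans ?_, RKHSPoly.Impl.isPolyhedron_poly G⟩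
      refine Real.rpow_le_rpow_of_exponent_le (by linarith [(t.cast_nonneg : (0 : ℝ) ≤ t)]) ?_
      gcongr
      norm_num
    · intro ε δ hε hε1 hδ hδ1 m
      exact ⟨hI.isPAC_proper hcont hD hDc ht hε hε1 hδ hδ1,
        hI.isPAC_improper hcont hD hDc ht hS hε hε1 hδ hδ1, fun hcube =>
        ⟨hI.isPAC_proper_grid hcont hD hDc hs hcube hε hε1 hδ hδ1,
          hI.isPAC_improper_grid hcont hD hDc hs hcube ht hS hε hε1 hδ hδ1⟩⟩
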